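/- Let $\mathsf{ZFA}$ be the first-order theory, in the language $\{\in\}$, obtained from $\mathsf{ZFC}$ by replacing the Axiom of Foundation with the Anti-Foundation Axiom: every flat system of equations $x = S_x$ ($x \in X$), where $X$ and $A$ are sets and $S_x \subseteq X \cup A$ for each $x\in X$, has a unique solution, i.e. there is exactly one function $f$ with domain $X$ such that $f(x) = (S_x \setminus X) \cup \{f(y) : y \in S_x \cap X\}$ for all $x \in X$. For a model $M$ of $\mathsf{ZFA}$, let $M_1$ be its double-membership graph, i.e. the structure with the same domain as $M$ and the single binary relation $D(x,y) :\iff x \in y \wedge y \in x$. Let $\mathrm{Th}(M_1)$ be the complete first-order theory of $M_1$ in the language $\{D\}$. Then the following hold for every $M \models \mathsf{ZFA}$. 1. For every $N \models \mathrm{Th}(M_1)$ and every finite set $\Delta$ of axioms of $\mathsf{ZFC}$, the structure $N$ interprets, with parameters, a model of $\Delta$. (That is, there are $d\in\mathbb N$, a set $U \subseteq N^d$ and an equivalence relation $\sim$ and a binary relation $E$ on $U$, with $E$ compatible with $\sim$, such that $U$, $\sim$ and $E$ are definable in $N$ with parameters and $(U/{\sim},\, E/{\sim}) \models \Delta$.)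 2. Consequently, the theory $T = \mathrm{Th}(M_1)$ has $\mathsf{SOP}$, $\mathsf{TP}_2$, and $\mathsf{IP}_k$ for all $k \geq 1$. Here $x, y, y_1, \dots, y_k$ denote finite tuples of variables, and * $T$ has $\mathsf{SOP}$ (the strict order property) if there are a formula $\varphi(x;y)$, a model $N \models T$ and tuples $(b_i)_{i\in\mathbb N}$ in $N$ such that $\varphi(N; b_i) \subsetneq \varphi(N; b_j)$ for all $i<j$; * $T$ has $\mathsf{TP}_2$ (the tree property of the second kind) if there are a formula $\varphi(x;y)$, a model $N \models T$ and tuples $(b_{i,j})_{i,j\in\mathbb N}$ in $N$ such that for every $i$ the formulas $\varphi(x;b_{i,j})$, $j \in \mathbb N$, are pairwise inconsistent, while for every $\eta\colon \mathbb N \to \mathbb N$ the set $\{\varphi(x;b_{i,\eta(i)}) : i\in\mathbb N\}$ is consistent (finitely satisfiable in $N$); * $T$ has $\mathsf{IP}_k$ (the $k$-independence property) if there are a formula $\varphi(x;y_1,\dots,y_k)$, a model $N \models T$ and tuples $(b_{i,j})_{1\le i\le k,\ j\in\mathbb N}$ in $N$ such that for every $X \subseteq \mathbb N^k$ the set $\{\varphi(x;b_{1,\eta(1)},\dots,b_{k,\eta(k)})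 : \eta \in X\} \cup \{\neg\varphi(x;b_{1,\eta(1)},\dots,b_{k,\eta(k)}) : \eta\in\mathbb N^k\setminus X\}$ is consistent (finitely satisfiable in $N$). -/

import Mathlib

open FirstOrder FirstOrder.Language

namespace DoubleMembership

universe u v w

/-! ### The language of set theory -/

/-- The only relation symbol of the language of set theory: a binary symbol for membership. -/
inductive MemRel : ℕ → Type
  | mem : MemRel 2

/-- The language `{∈}` of set theory. -/
def memLang : FirstOrder.Language.{0, 0} := ⟨fun _ => Empty, MemRel⟩

/-- The symbol `∈`. -/
abbrev memSym : memLang.Relations 2 := MemRel.mem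

/-- Set-theoretic formulas whose free variables are `v₀, …, vₙ₋₁`. A quantifier in front of a
formula in `v₀, …, vₙ` binds the variable `vₙ`; hence, reading from the outside, the quantifiers of
a sentence bind `v₀`, `v₁`, `v₂`, …. -/
abbrev SetFormula (n : ℕ) : Type := memLang.BoundedFormula Empty n

/-- The variable `vₙ₊ⱼ` among `v₀, …, vₙ₊ₖ₋₁`: in the context obtained from `v₀, …, vₙ₋₁` by passing
`k` quantifiers, this is the variable bound by the `j`-th of these quantifiers (counted from `0`). -/
abbrev bv (n k : ℕ) (j : Fin k) : Fin (n + k) := Fin.natAdd n j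

/-- `vᵢ ∈ vⱼ` -/
def memF {n : ℕ} (i j : Fin n) : SetFormula n :=
  memSym.boundedFormula₂ (Term.var (Sum.inr i)) (Term.var (Sum.inr j))

/-- `vᵢ = vⱼ` -/
def eqF {n : ℕ} (i j : Fin n) : SetFormula n :=
  Term.bdEqual (Term.var (Sum.inr i)) (Term.var (Sum.inr j))

/-- The formula obtained from `φ` by renaming its free variables along `σ`. -/
def substF {α : Type} {n : ℕ} (φ : memLang.Formula α) (σ : α → Fin n) : SetFormula n :=
  BoundedFormula.relabel (n := n) (k := 0) (fun a => Sum.inr (σ a)) φ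

/-- `z = {x, y}` -/
def isUnorderedPairF {n : ℕ} (z x y : Fin n) : SetFormula n :=
  ∀' ((memF (Fin.last n) z.castSucc) ⇔
    ((eqF (Fin.last n) x.castSucc) ⊔ (eqF (Fin.last n) y.castSucc)))

/-- `p = {{x, x}, {x, y}}`, that is, `p` is the Kuratowski pair `(x, y)`. -/
def isPairF {n : ℕ} (p x y : Fin n) : SetFormula n :=
  ∀' ((memF (Fin.last n) p.castSucc) ⇔
    ((isUnorderedPairF (Fin.last n) x.castSucc x.castSucc) ⊔
      (isUnorderedPairF (Fin.last n) x.castSucc y.castSucc)))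

/-- `(x, y) ∈ f` -/
def appF {n : ℕ} (f x y : Fin n) : SetFormula n :=
  ∃' ((memF (Fin.last n) f.castSucc) ⊓ (isPairF (Fin.last n) x.castSucc y.castSucc))

/-- `f` is a function with domain `X`: every element of `f` is a pair with first coordinate in `X`,
and for every `x ∈ X` there is exactly one `y` with `(x, y) ∈ f`. -/
def isFunF {n : ℕ} (f X : Fin n) : SetFormula n :=
  (∀' ((memF (Fin.last n) f.castSucc) ⟹
    (∃' ∃' ((memF (bv n 3 1) (Fin.castAdd 3 X)) ⊓
      (isPairF (bv n 3 0) (bv n 3 1) (bv n 3 2)))))) ⊓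
  (∀' ((memF (Fin.last n) X.castSucc) ⟹
    (∃' ((appF (Fin.castAdd 2 f) (bv n 2 0) (bv n 2 1)) ⊓
      (∀' ((appF (Fin.castAdd 3 f) (bv n 3 0) (bv n 3 2)) ⟹
        (eqF (bv n 3 2) (bv n 3 1))))))))

/-! ### Axioms of set theory -/

/-- Extensionality: `∀ x y, (∀ z, z ∈ x ↔ z ∈ y) → x = y`. -/
def extensionality : memLang.Sentence :=
  ∀' ∀' ((∀' ((memF (2 : Fin 3) 0) ⇔ (memF 2 1))) ⟹ (eqF 0 1))

/-- Foundation: every non-empty `x` has an element `y` that is disjoint from `x`. -/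
def foundation : memLang.Sentence :=
  ∀' ((∃' (memF (1 : Fin 2) 0)) ⟹
    (∃' ((memF (1 : Fin 2) 0) ⊓ (∀' ((memF (2 : Fin 3) 0) ⟹ ∼(memF (2 : Fin 3) 1))))))

/-- Pairing: for all `x`, `y` there is a set whose elements are exactly `x` and `y`. -/
def pairing : memLang.Sentence :=
  ∀' ∀' ∃' (isUnorderedPairF (2 : Fin 3) 0 1)

/-- Union: `∀ x, ∃ u, ∀ z, z ∈ u ↔ ∃ y, y ∈ x ∧ z ∈ y`. -/
def union : memLang.Sentence :=
  ∀' ∃' ∀' ((memF (2 : Fin 3) 1) ⇔ (∃' ((memF (3 : Fin 4) 0) ⊓ (memF 2 3))))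

/-- Power set: `∀ x, ∃ p, ∀ y, y ∈ p ↔ ∀ z, z ∈ y → z ∈ x`. -/
def powerSet : memLang.Sentence :=
  ∀' ∃' ∀' ((memF (2 : Fin 3) 1) ⇔ (∀' ((memF (3 : Fin 4) 2) ⟹ (memF 3 0))))

/-- Infinity: there is `w` that has an empty element and such that, for every `x ∈ w`, the set
`x ∪ {x}` is an element of `w`. -/
def infinity : memLang.Sentence :=
  ∃' ((∃' ((memF (1 : Fin 2) 0) ⊓ (∀' ∼(memF (2 : Fin 3) 1)))) ⊓
    (∀' ((memF (1 : Fin 2) 0) ⟹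
      (∃' ((memF (2 : Fin 3) 0) ⊓
        (∀' ((memF (3 : Fin 4) 2) ⇔ ((memF 3 1) ⊔ (eqF 3 1)))))))))

/-- Choice: if the elements of `F` are non-empty and pairwise disjoint, then there is `c` that
meets every element of `F` in exactly one point. -/
def choice : memLang.Sentence :=
  ∀' (((∀' ((memF (1 : Fin 2) 0) ⟹ (∃' (memF (2 : Fin 3) 1)))) ⊓
      (∀' ∀' ∀' (((((memF (1 : Fin 4) 0) ⊓ (memF 2 0)) ⊓ (memF 3 1)) ⊓ (memF 3 2)) ⟹ (eqF 1 2)))) ⟹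
    (∃' ∀' ((memF (2 : Fin 3) 0) ⟹
      (∃' (((memF (3 : Fin 4) 2) ⊓ (memF 3 1)) ⊓
        (∀' (((memF (4 : Fin 5) 2) ⊓ (memF 4 1)) ⟹ (eqF 4 3))))))))

/-- The instance of Separation for `φ(p, x)`:
`∀ p a, ∃ b, ∀ x, x ∈ b ↔ x ∈ a ∧ φ(p, x)`. -/
def separation {n : ℕ} (φ : memLang.Formula (Fin n ⊕ Fin 1)) : memLang.Sentence :=
  BoundedFormula.alls (n := n) (∀' ∃' ∀'
    ((memF (bv n 3 2) (bv n 3 1)) ⇔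
      ((memF (bv n 3 2) (bv n 3 0)) ⊓
        (substF φ (Sum.elim (Fin.castAdd 3) ![bv n 3 2])))))

/-- The instance of Replacement for `φ(p, x, y)`:
`∀ p a, (∀ x y z, x ∈ a ∧ φ(p, x, y) ∧ φ(p, x, z) → y = z) →
  ∃ b, ∀ y, y ∈ b ↔ ∃ x, x ∈ a ∧ φ(p, x, y)`. -/
def replacement {n : ℕ} (φ : memLang.Formula (Fin n ⊕ Fin 2)) : memLang.Sentence :=
  BoundedFormula.alls (n := n) (∀'
    ((∀' ∀' ∀'
      ((((memF (bv n 4 1) (bv n 4 0)) ⊓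
          (substF φ (Sum.elim (Fin.castAdd 4) ![bv n 4 1, bv n 4 2]))) ⊓
          (substF φ (Sum.elim (Fin.castAdd 4) ![bv n 4 1, bv n 4 3]))) ⟹
        (eqF (bv n 4 2) (bv n 4 3)))) ⟹
    (∃' ∀'
      ((memF (bv n 3 2) (bv n 3 1)) ⇔
        (∃' ((memF (bv n 4 3) (bv n 4 0)) ⊓
          (substF φ (Sum.elim (Fin.castAdd 4) ![bv n 4 3, bv n 4 2]))))))))

/-- A flat system of equations with set of indeterminates `X` and set of constants `A` is a function
`S` with domain `X` such that `S(x) ⊆ X ∪ A` for all `x ∈ X`; it stands for the equations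
`x = S(x)`, `x ∈ X`. -/
def isFlatSystemF {n : ℕ} (X A S : Fin n) : SetFormula n :=
  (isFunF S X) ⊓
  (∀' ∀' ∀' ((((memF (bv n 3 0) (Fin.castAdd 3 X)) ⊓
      (appF (Fin.castAdd 3 S) (bv n 3 0) (bv n 3 1))) ⊓
      (memF (bv n 3 2) (bv n 3 1))) ⟹
    ((memF (bv n 3 2) (Fin.castAdd 3 X)) ⊔ (memF (bv n 3 2) (Fin.castAdd 3 A)))))

/-- `f` solves the system `x = S(x)`, `x ∈ X`: it is a function with domain `X`, and replacing the
indeterminates by their values turns every equation into a true one, that is,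
`f(x) = {z ∈ S(x) | z ∉ X} ∪ {f(y) | y ∈ S(x) ∩ X}` for all `x ∈ X`. The variables bound by the
successive quantifiers are `x`, `s = S(x)`, `t = f(x)`, `z`, `y`. -/
def isSolutionF {n : ℕ} (f X S : Fin n) : SetFormula n :=
  (isFunF f X) ⊓
  (∀' ∀' ∀' ((((memF (bv n 3 0) (Fin.castAdd 3 X)) ⊓
      (appF (Fin.castAdd 3 S) (bv n 3 0) (bv n 3 1))) ⊓
      (appF (Fin.castAdd 3 f) (bv n 3 0) (bv n 3 2))) ⟹
    (∀' ((memF (bv n 4 3) (bv n 4 2)) ⇔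
      (((memF (bv n 4 3) (bv n 4 1)) ⊓ ∼(memF (bv n 4 3) (Fin.castAdd 4 X))) ⊔
        (∃' (((memF (bv n 5 4) (bv n 5 1)) ⊓
          (memF (bv n 5 4) (Fin.castAdd 5 X))) ⊓
          (appF (Fin.castAdd 5 f) (bv n 5 4) (bv n 5 3)))))))))

/-- The Anti-Foundation Axiom: every flat system of equations has a unique solution. -/
def antiFoundation : memLang.Sentence :=
  ∀' ∀' ∀' ((isFlatSystemF (0 : Fin 3) 1 2) ⟹
    (∃' ((isSolutionF (3 : Fin 4) 0 2) ⊓ (∀' ((isSolutionF (4 : Fin 5) 0 2) ⟹ (eqF 4 3))))))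

/-- `ZFC` without the Axiom of Foundation. -/
def ZFCWithoutFoundation : memLang.Theory :=
  {extensionality, pairing, union, powerSet, infinity, choice} ∪
  {θ | ∃ (n : ℕ) (φ : memLang.Formula (Fin n ⊕ Fin 1)), θ = separation φ} ∪
  {θ | ∃ (n : ℕ) (φ : memLang.Formula (Fin n ⊕ Fin 2)), θ = replacement φ}

/-- Zermelo–Fraenkel set theory with Choice. -/
def ZFC : memLang.Theory := ZFCWithoutFoundation ∪ {foundation}

/-- `ZFC` with Foundation replaced by the Anti-Foundation Axiom. -/
def ZFA : memLang.Theory := ZFCWithoutFoundation ∪ {antiFoundation}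

/-! ### Double-membership graphs -/

/-- The domain of the double-membership graph of `M`, which is that of `M`. -/
def DGraph (M : Type u) : Type u := M

/-- The double-membership graph of `M`: `x` and `y` are adjacent iff `x ∈ y` and `y ∈ x`. -/
instance {M : Type u} [memLang.Structure M] : FirstOrder.Language.graph.Structure (DGraph M) where
  RelMap | .adj => fun x =>
    Structure.RelMap (M := M) memSym ![x 0, x 1] ∧ Structure.RelMap (M := M) memSym ![x 1, x 0]

/-! ### Interpretations with parameters -/

/-- The `L`-structure `N` interprets the (non-empty) `L'`-structure `A` with parameters: for some
`d` there are a set `dom ⊆ Nᵈ` and a surjection `f` from `dom` onto `A` (the values of `f` outside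
`dom` play no role) such that `dom` and the preimages under `f` of equality, of the relations and
of the graphs of the functions of `A` are definable in `N` with parameters. -/
def Interprets (L : FirstOrder.Language.{u, v}) (N : Type w) [L.Structure N]
    (L' : FirstOrder.Language.{u, v}) (A : Type w) [L'.Structure A] : Prop :=
  ∃ (d : ℕ) (dom : Set (Fin d → N)) (f : (Fin d → N) → A),
    Set.SurjOn f dom Set.univ ∧
    (Set.univ : Set N).Definable L dom ∧
    (Set.univ : Set N).Definable L {t : Fin 2 × Fin d → N |
      (∀ i, (fun j => t (i, j)) ∈ dom) ∧ f (fun j => t (0, j)) = f (fun j => t (1, j))} ∧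
    (∀ (k : ℕ) (R : L'.Relations k), (Set.univ : Set N).Definable L {t : Fin k × Fin d → N |
      (∀ i, (fun j => t (i, j)) ∈ dom) ∧
        Structure.RelMap R (fun i => f (fun j => t (i, j)))}) ∧
    (∀ (k : ℕ) (F : L'.Functions k), (Set.univ : Set N).Definable L
      {t : Fin (k + 1) × Fin d → N |
        (∀ i, (fun j => t (i, j)) ∈ dom) ∧
          Structure.funMap F (fun i : Fin k => f (fun j => t (i.castSucc, j))) =
            f (fun j => t (Fin.last k, j))})

/-- `N` interprets the theory `T'` with parameters: it interprets some model of `T'`. (A structure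
interpreted in `N` is a quotient of a set of tuples from `N`, so no larger universe is needed.) -/
def InterpretsTheory (L : FirstOrder.Language.{u, v}) (N : Type w) [L.Structure N]
    {L' : FirstOrder.Language.{u, v}} (T' : L'.Theory) : Prop :=
  ∃ (A : Type w) (_ : L'.Structure A), Nonempty A ∧ A ⊨ T' ∧ Interprets L N L' A

/-! ### Dividing lines -/

/-- The strict order property: there are a formula `φ(x; y)` and, in some model, tuples
`b₀, b₁, …` such that the sets defined by `φ(x; bᵢ)` form a strictly increasing sequence. -/
def HasSOP {L : FirstOrder.Language.{u, v}} (T : L.Theory) : Prop :=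
  ∃ (m n : ℕ) (φ : L.Formula (Fin m ⊕ Fin n)) (N : Theory.ModelType.{u, v, max u v} T)
    (b : ℕ → Fin n → N),
    ∀ i j : ℕ, i < j →
      {x : Fin m → N | φ.Realize (Sum.elim x (b i))} ⊂
        {x : Fin m → N | φ.Realize (Sum.elim x (b j))}

/-- The tree property of the second kind: there are a formula `φ(x; y)` and, in some model, an
array of tuples `(bᵢⱼ)` such that for every `i` the formulas `φ(x; bᵢⱼ)`, `j ∈ ℕ`, are pairwise
inconsistent, while for every `η : ℕ → ℕ` the set of the formulas `φ(x; bᵢ,η(i))`, `i ∈ ℕ`, is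
consistent, that is, finitely satisfiable in the model. -/
def HasTP2 {L : FirstOrder.Language.{u, v}} (T : L.Theory) : Prop :=
  ∃ (m n : ℕ) (φ : L.Formula (Fin m ⊕ Fin n)) (N : Theory.ModelType.{u, v, max u v} T)
    (b : ℕ → ℕ → Fin n → N),
    (∀ i j j' : ℕ, j ≠ j' → ¬ ∃ x : Fin m → N,
      φ.Realize (Sum.elim x (b i j)) ∧ φ.Realize (Sum.elim x (b i j'))) ∧
    (∀ (η : ℕ → ℕ) (I : Finset ℕ), ∃ x : Fin m → N,
      ∀ i ∈ I, φ.Realize (Sum.elim x (b i (η i))))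

/-- The `k`-independence property: there are a formula `φ(x; y₁, …, yₖ)` and, in some model,
sequences of tuples `(bᵢⱼ)`, `j ∈ ℕ`, for `1 ≤ i ≤ k`, such that for every `X ⊆ ℕᵏ` the set
consisting of the formulas `φ(x; b₁,η(1), …, bₖ,η(k))` for `η ∈ X` and of their negations for
`η ∉ X` is consistent, that is, finitely satisfiable in the model. -/
def HasIP {L : FirstOrder.Language.{u, v}} (k : ℕ) (T : L.Theory) : Prop :=
  ∃ (m : ℕ) (n : Fin k → ℕ) (φ : L.Formula (Fin m ⊕ (Σ i : Fin k, Fin (n i))))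
    (N : Theory.ModelType.{u, v, max u v} T) (b : (i : Fin k) → ℕ → Fin (n i) → N),
    ∀ (X : Set (Fin k → ℕ)) (I : Finset (Fin k → ℕ)), ∃ x : Fin m → N,
      ∀ η ∈ I, φ.Realize (Sum.elim x (fun p => b p.1 (η p.1) p.2)) ↔ η ∈ X

end DoubleMembership

/-!
The argument has two halves: inside the model `M` of `ZFA` there is a set model, coded by a graph,
of any given finite part of `ZFC`; and whatever finite graphs show about definable families survives
in the complete theory by compactness.

*Graphs from Anti-Foundation.* Let `R` be a definable symmetric relation on a set `V`. The flat
system whose equation for `v ∈ V` lists the `R`-neighbours of `v`, together with a constant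
`marker v`, has a solution `f`. The markers keep the sets `f v` distinct, and their being built from
sets that contain `∅`, while no `f v` does, excludes any further double membership. Hence `f` is an
isomorphism of `(V, R)` onto a union of connected components of the double-membership graph
(`exists_realization_of_graph`); a finite number of disjoint copies of a set is handled by tagging
(`exists_realization_of_family`).

*Set models of finite parts of `ZFC`.* Foundation fails in `M`, so the well-founded part has to be
carved out. Ordinals are avoided by describing the levels of the cumulative hierarchy through their
histories, the sets of all earlier levels. Levels are well-ordered by membership because a nonempty
definable class of sets closed under subsets of their elements has an `∈`-minimal member, by
Russell's paradox and without Foundation (`exists_minimal_of_potent`). The union `WF` of the levels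
is a model of `ZFC` (`WF.models_ZFC`). Collection over levels gives the reflection principle
(`exists_reflecting`, `Bounding.exists_closedLevel`), so that every finite part of `ZFC` holds in
some level, a set of `M` (`exists_set_model`).

*Transfer.* A set `s` of `M` with its membership relation is encoded by a symmetric graph on four
copies of `s`, which is realized in the double-membership graph in such a way that the neighbours of
one vertex `p` recover `(s, ∈)` (`exists_coded_equiv`). That some vertex codes in this manner a
nonempty model of a finite theory `Δ` is a single first-order sentence `existsCodeF Δ`, so it is
true in every model of the complete theory of the graph, and a vertex witnessing it is the
parameter of the interpretation (`interprets_coded`).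

*Dividing lines.* Every finite symmetric graph is realized in the double-membership graph. Half
graphs, incidence graphs of array entries against choice functions, and incidence graphs of
transversals against sets of transversals give finite approximations, as long as desired, to the
patterns in the definitions of `SOP`, `TP₂` and `IP_k`. Each approximation is a first-order
statement about finitely many members of the array, so compactness
(`exists_model_realizing_sequence`) yields a model with the full pattern.
-/

namespace DoubleMembership

universe u v w

/-! ### Definable predicates and functions -/

section Definability

variable {M : Type u} [memLang.Structure M]

/-- `x ε y`: in the structure `M`, `x` is an element of `y`. -/
def Mem (x y : M) : Prop := Structure.RelMap memSym ![x, y]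

infix:50 " ε " => Mem

/-- The predicate `P` on tuples from `M` is first-order definable in `M` with parameters. It is
a class so that definability of a predicate written with connectives, quantifiers and definable
functions is found by instance search. -/
class FO {α : Type} (P : (α → M) → Prop) : Prop where
  out : (Set.univ : Set M).Definable memLang {v | P v}

/-- The function `f` on tuples from `M` is definable in `M` with parameters. -/
class DF {α : Type} (f : (α → M) → M) : Prop where
  out : (Set.univ : Set M).DefinableFun memLang f

variable {α β : Type}

instance DF.proj (i : α) : DF (fun v : α → M => v i) :=
  ⟨Set.DefinableFun.proj memLang⟩

instance DF.const (c : M) : DF (fun _ : α → M => c) :=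
  ⟨definableFun_const memLang α (Set.mem_univ c)⟩

theorem FO.of_iff {P Q : (α → M) → Prop} (h : ∀ v, P v ↔ Q v) [hQ : FO Q] : FO P := by
  have : P = Q := funext fun v => propext (h v)
  exact this ▸ hQ

/-- Substituting definable functions for the variables of a definable predicate. -/
theorem FO.subst [Finite β] {P : (β → M) → Prop} (hP : FO P) (f : β → (α → M) → M)
    (hf : ∀ i, DF (f i)) : FO (fun v => P (fun i => f i v)) :=
  ⟨Set.Definable.preimage_map (F := fun v i => f i v) (fun i => (hf i).out) hP.out⟩

/-- Substituting definable functions for the variables of a definable function. -/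
theorem DF.subst [Finite β] {F : (β → M) → M} (hF : DF F) (f : β → (α → M) → M)
    (hf : ∀ i, DF (f i)) : DF (fun v => F (fun i => f i v)) :=
  ⟨Set.DefinableFun.comp (g := fun v i => f i v) (fun i => (hf i).out) hF.out⟩

/-- Renaming variables. -/
theorem FO.rename {P : (β → M) → Prop} (hP : FO P) (σ : β → α) :
    FO (fun v : α → M => P (fun i => v (σ i))) :=
  ⟨hP.out.preimage_comp σ⟩

instance FO.false : FO (fun _ : α → M => False) := ⟨Set.definable_empty⟩
instance FO.true : FO (fun _ : α → M => True) := ⟨Set.definable_univ⟩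

instance FO.and {P Q : (α → M) → Prop} [hP : FO P] [hQ : FO Q] : FO (fun v => P v ∧ Q v) :=
  ⟨hP.out.inter hQ.out⟩

instance FO.or {P Q : (α → M) → Prop} [hP : FO P] [hQ : FO Q] : FO (fun v => P v ∨ Q v) :=
  ⟨hP.out.union hQ.out⟩

instance FO.not {P : (α → M) → Prop} [hP : FO P] : FO (fun v => ¬ P v) := ⟨hP.out.compl⟩

instance FO.imp {P Q : (α → M) → Prop} [hP : FO P] [hQ : FO Q] : FO (fun v => P v → Q v) :=
  FO.of_iff (Q := fun v => ¬ P v ∨ Q v) fun _ => imp_iff_not_or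

instance FO.iff {P Q : (α → M) → Prop} [hP : FO P] [hQ : FO Q] : FO (fun v => P v ↔ Q v) :=
  FO.of_iff (Q := fun v => (P v → Q v) ∧ (Q v → P v)) fun _ => iff_iff_implies_and_implies

instance FO.exists {P : (α → M) → M → Prop}
    [hP : FO (fun w : α ⊕ Unit → M => P (fun i => w (Sum.inl i)) (w (Sum.inr ())))] :
    FO (fun v => ∃ x, P v x) := by
  refine ⟨?_⟩
  convert! Set.Definable.exists_of_finite hP.out using 1
  ext v
  exact ⟨fun ⟨x, hx⟩ => ⟨fun _ => x, hx⟩, fun ⟨x, hx⟩ => ⟨x (), hx⟩⟩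

instance FO.forall {P : (α → M) → M → Prop}
    [hP : FO (fun w : α ⊕ Unit → M => P (fun i => w (Sum.inl i)) (w (Sum.inr ())))] :
    FO (fun v => ∀ x, P v x) :=
  FO.of_iff (Q := fun v => ¬ ∃ x, ¬ P v x) fun _ => by simp

/-- Quantification over finite tuples. -/
theorem FO.forall_tuple [Finite β] {P : (α → M) → (β → M) → Prop}
    (hP : FO (fun w : α ⊕ β → M => P (fun i => w (Sum.inl i)) (fun i => w (Sum.inr i)))) :
    FO (fun v => ∀ x, P v x) :=
  ⟨Set.Definable.forall_of_finite hP.out⟩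

theorem FO.forall_finite {ι : Type} [Finite ι] {P : ι → (α → M) → Prop} (hP : ∀ i, FO (P i)) :
    FO (fun v => ∀ i, P i v) := by
  refine ⟨?_⟩
  rw [Set.ofPred_forall]
  exact Set.definable_iInter_of_finite fun i => (hP i).out

instance FO.eq {f g : (α → M) → M} [hf : DF f] [hg : DF g] : FO (fun v => f v = g v) :=
  ⟨Set.DefinableFun.ofPred_eq hf.out hg.out⟩

theorem FO.mem_base : FO (fun v : Fin 2 → M => v 0 ε v 1) := by
  refine ⟨Set.Definable.mono ?_ (Set.empty_subset _)⟩
  refine Set.empty_definable_iff.2 ⟨memSym.formula₂ (Term.var 0) (Term.var 1), ?_⟩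
  ext v
  simp [Mem]

instance FO.mem {f g : (α → M) → M} [hf : DF f] [hg : DF g] : FO (fun v => f v ε g v) := by
  simpa using FO.mem_base.subst ![f, g] (fun i => by fin_cases i <;> assumption)

/-- The unary predicate `P` is definable with parameters. -/
abbrev FO₁ (P : M → Prop) : Prop := FO (fun v : Fin 1 → M => P (v 0))

/-- The binary predicate `P` is definable with parameters. -/
abbrev FO₂ (P : M → M → Prop) : Prop := FO (fun v : Fin 2 → M => P (v 0) (v 1))

/-- The unary function `F` is definable with parameters. -/
abbrev DF₁ (F : M → M) : Prop := DF (fun v : Fin 1 → M => F (v 0))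

/-- The binary function `F` is definable with parameters. -/
abbrev DF₂ (F : M → M → M) : Prop := DF (fun v : Fin 2 → M => F (v 0) (v 1))

theorem FO.app₁ {P : M → Prop} (hP : FO₁ P) {f : (α → M) → M} [hf : DF f] :
    FO (fun v => P (f v)) :=
  FO.subst hP (fun _ => f) (fun _ => hf)

theorem FO.app₂ {P : M → M → Prop} (hP : FO₂ P) {f g : (α → M) → M} [hf : DF f] [hg : DF g] :
    FO (fun v => P (f v) (g v)) := by
  simpa using FO.subst hP ![f, g] (fun i => by fin_cases i <;> assumption)

theorem DF.app₁ {F : M → M} (hF : DF₁ F) {f : (α → M) → M} [hf : DF f] :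
    DF (fun v => F (f v)) :=
  DF.subst hF (fun _ => f) (fun _ => hf)

theorem DF.app₂ {F : M → M → M} (hF : DF₂ F) {f g : (α → M) → M} [hf : DF f] [hg : DF g] :
    DF (fun v => F (f v) (g v)) := by
  simpa using DF.subst hF ![f, g] (fun i => by fin_cases i <;> assumption)

/-- A function is definable if its graph is. -/
theorem DF.of_graph {f : (α → M) → M}
    (h : FO (fun w : α ⊕ Unit → M => f (fun i => w (Sum.inl i)) = w (Sum.inr ()))) : DF f := by
  refine ⟨?_⟩
  have := h.out.preimage_comp (fun | Sum.inl i => some i | Sum.inr () => none : α ⊕ Unit → Option α)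
  convert! this using 1

/-- A definable predicate on an indexed product is given by a formula with finitely many
parameters. -/
theorem FO.exists_formula {P : (β → M) → Prop} (hP : FO P) :
    ∃ (n : ℕ) (φ : memLang.Formula (Fin n ⊕ β)) (p : Fin n → M),
      ∀ v, φ.Realize (Sum.elim p v) ↔ P v := by
  classical
  obtain ⟨φ, hφ⟩ := Set.definable_iff_exists_formula_sum.1 hP.out
  -- Only the finitely many parameters that occur in `φ` are kept.
  let s : Finset (Set.univ : Set M) := φ.freeVarFinset.toLeft
  let e := s.equivFin
  have key : ∀ a : φ.freeVarFinset, ∃ b : Fin s.card ⊕ β,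
      ∀ v : β → M, Sum.elim (fun i => ((e.symm i : (Set.univ : Set M)) : M)) v b =
        Sum.elim (fun a : (Set.univ : Set M) => (a : M)) v a := by
    rintro ⟨a | b, h⟩
    · exact ⟨Sum.inl (e ⟨a, by simpa [s] using h⟩), by simp⟩
    · exact ⟨Sum.inr b, by simp⟩
  choose g hg using key
  refine ⟨s.card, φ.restrictFreeVar g, fun i => ((e.symm i : (Set.univ : Set M)) : M), fun v => ?_⟩
  have h1 : P v ↔ φ.Realize (Sum.elim (fun a : (Set.univ : Set M) => (a : M)) v) := by
    have := congrArg (fun S => v ∈ S) hφ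
    simpa using this
  rw [h1]
  exact BoundedFormula.realize_restrictFreeVar _ (fun a => hg a v)

end Definability

/-! ### Meaning of the axioms -/

section Axioms

variable {M : Type u} [memLang.Structure M] {n : ℕ} {d : Empty → M} {v : Fin n → M}

@[simp]
theorem realize_memF {i j : Fin n} : (memF i j).Realize d v ↔ v i ε v j := by
  simp [memF, Mem]

@[simp]
theorem realize_eqF {i j : Fin n} : (eqF i j).Realize d v ↔ v i = v j := by
  simp [eqF]

@[simp]
theorem realize_substF {α : Type} {φ : memLang.Formula α} {σ : α → Fin n} :
    (substF φ σ).Realize d v ↔ φ.Realize (fun a => v (σ a)) := by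
  unfold substF Formula.Realize
  rw [BoundedFormula.realize_relabel]
  refine Iff.of_eq ?_
  congr 1
  exact Subsingleton.elim _ _

theorem val_lt_add (X : Fin n) (k : ℕ) : (X : ℕ) < n + k := Nat.lt_add_right k X.2

@[simp]
theorem realize_isUnorderedPairF {z x y : Fin n} : (isUnorderedPairF z x y).Realize d v ↔
    ∀ t, t ε v z ↔ t = v x ∨ t = v y := by
  simp [isUnorderedPairF]

theorem realize_extensionality : M ⊨ extensionality ↔
    ∀ x y : M, (∀ z, z ε x ↔ z ε y) → x = y := by
  simp [Sentence.Realize, Formula.Realize, extensionality, Fin.snoc]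

theorem realize_foundation : M ⊨ foundation ↔
    ∀ x : M, (∃ y, y ε x) → ∃ y, y ε x ∧ ∀ z, z ε x → ¬ z ε y := by
  simp [Sentence.Realize, Formula.Realize, foundation, Fin.snoc]

theorem realize_pairing : M ⊨ pairing ↔
    ∀ x y : M, ∃ z, ∀ t, t ε z ↔ t = x ∨ t = y := by
  simp [Sentence.Realize, Formula.Realize, pairing, Fin.snoc]

theorem realize_union : M ⊨ union ↔
    ∀ x : M, ∃ u, ∀ z, z ε u ↔ ∃ y, y ε x ∧ z ε y := by
  simp [Sentence.Realize, Formula.Realize, union, Fin.snoc]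

theorem realize_powerSet : M ⊨ powerSet ↔
    ∀ x : M, ∃ p, ∀ y, y ε p ↔ ∀ z, z ε y → z ε x := by
  simp [Sentence.Realize, Formula.Realize, powerSet, Fin.snoc]

theorem realize_infinity : M ⊨ infinity ↔
    ∃ w : M, (∃ e, e ε w ∧ ∀ z, ¬ z ε e) ∧
      ∀ x, x ε w → ∃ y, y ε w ∧ ∀ z, z ε y ↔ z ε x ∨ z = x := by
  simp [Sentence.Realize, Formula.Realize, infinity, Fin.snoc]

theorem realize_choice : M ⊨ choice ↔
    ∀ F : M, (∀ x, x ε F → ∃ y, y ε x) →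
      (∀ x y z, x ε F → y ε F → z ε x → z ε y → x = y) →
      ∃ c, ∀ x, x ε F → ∃ y, (y ε x ∧ y ε c) ∧ ∀ z, z ε x → z ε c → z = y := by
  simp [Sentence.Realize, Formula.Realize, choice, Fin.snoc]

theorem realize_separation (φ : memLang.Formula (Fin n ⊕ Fin 1)) : M ⊨ separation φ ↔
    ∀ (p : Fin n → M) (a : M), ∃ b, ∀ x, x ε b ↔ x ε a ∧ φ.Realize (Sum.elim p ![x]) := by
  have h : ∀ (p : Fin n → M) (a b x : M),
      (fun i => (Fin.snoc (Fin.snoc (Fin.snoc p a) b) x : Fin (n + 3) → M)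
        (Sum.elim (Fin.castAdd 3) ![bv n 3 2] i)) = Sum.elim p ![x] := by
    intro p a b x
    ext (i | i)
    · simp [Fin.snoc, val_lt_add]; rfl
    · simp [Fin.snoc]
  simp [Sentence.Realize, separation, h, BoundedFormula.realize_alls]
  simp [Fin.snoc]

theorem realize_replacement (φ : memLang.Formula (Fin n ⊕ Fin 2)) : M ⊨ replacement φ ↔
    ∀ (p : Fin n → M) (a : M),
      (∀ x y z, x ε a → φ.Realize (Sum.elim p ![x, y]) → φ.Realize (Sum.elim p ![x, z]) → y = z) →
      ∃ b, ∀ y, y ε b ↔ ∃ x, x ε a ∧ φ.Realize (Sum.elim p ![x, y]) := by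
  have h1 : ∀ (p : Fin n → M) (a b c e : M),
      (fun i => (Fin.snoc (Fin.snoc (Fin.snoc (Fin.snoc p a) b) c) e : Fin (n + 4) → M)
        (Sum.elim (Fin.castAdd 4) ![bv n 4 1, bv n 4 2] i)) = Sum.elim p ![b, c] := by
    intro p a b c e
    ext (i | i)
    · simp [Fin.snoc, val_lt_add]; rfl
    · fin_cases i <;> simp [Fin.snoc]
  have h2 : ∀ (p : Fin n → M) (a b c e : M),
      (fun i => (Fin.snoc (Fin.snoc (Fin.snoc (Fin.snoc p a) b) c) e : Fin (n + 4) → M)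
        (Sum.elim (Fin.castAdd 4) ![bv n 4 1, bv n 4 3] i)) = Sum.elim p ![b, e] := by
    intro p a b c e
    ext (i | i)
    · simp [Fin.snoc, val_lt_add]; rfl
    · fin_cases i <;> simp [Fin.snoc]
  have h3 : ∀ (p : Fin n → M) (a b c e : M),
      (fun i => (Fin.snoc (Fin.snoc (Fin.snoc (Fin.snoc p a) b) c) e : Fin (n + 4) → M)
        (Sum.elim (Fin.castAdd 4) ![bv n 4 3, bv n 4 2] i)) = Sum.elim p ![e, c] := by
    intro p a b c e
    ext (i | i)
    · simp [Fin.snoc, val_lt_add]; rfl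
    · fin_cases i <;> simp [Fin.snoc]
  simp [Sentence.Realize, replacement, h1, h2, h3, BoundedFormula.realize_alls]
  simp [Fin.snoc]

/-- `p` is the Kuratowski pair of `x` and `y`. -/
def IsPair (p x y : M) : Prop :=
  ∀ t, t ε p ↔ (∀ s, s ε t ↔ s = x) ∨ (∀ s, s ε t ↔ s = x ∨ s = y)

/-- `(x, y) ∈ f` -/
def App (f x y : M) : Prop := ∃ p, p ε f ∧ IsPair p x y

/-- `f` is a function with domain `X`. -/
def IsFun (f X : M) : Prop :=
  (∀ p, p ε f → ∃ x y, x ε X ∧ IsPair p x y) ∧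
    ∀ x, x ε X → ∃ y, App f x y ∧ ∀ z, App f x z → z = y

@[simp]
theorem realize_isPairF {p x y : Fin n} : (isPairF p x y).Realize d v ↔
    IsPair (v p) (v x) (v y) := by
  simp [isPairF, IsPair]

@[simp]
theorem realize_appF {f x y : Fin n} : (appF f x y).Realize d v ↔ App (v f) (v x) (v y) := by
  simp [appF, App]

@[simp]
theorem realize_isFunF {f X : Fin n} : (isFunF f X).Realize d v ↔ IsFun (v f) (v X) := by
  simp [isFunF, IsFun]
  simp [Fin.snoc]

theorem realize_antiFoundation : M ⊨ antiFoundation ↔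
    ∀ X A S : M, IsFun S X → (∀ x s z, x ε X → App S x s → z ε s → z ε X ∨ z ε A) →
      ∃ f, (IsFun f X ∧ ∀ x s t, x ε X → App S x s → App f x t →
        ∀ z, z ε t ↔ (z ε s ∧ ¬ z ε X) ∨ ∃ y, (y ε s ∧ y ε X) ∧ App f y z) ∧
      ∀ g, (IsFun g X ∧ ∀ x s t, x ε X → App S x s → App g x t →
        ∀ z, z ε t ↔ (z ε s ∧ ¬ z ε X) ∨ ∃ y, (y ε s ∧ y ε X) ∧ App g y z) → g = f := by
  simp [Sentence.Realize, Formula.Realize, antiFoundation, isFlatSystemF, isSolutionF]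
  simp [Fin.snoc]

end Axioms

/-! ### Sets of a model -/

section Sets

variable {M : Type u} [memLang.Structure M] [hM : M ⊨ ZFCWithoutFoundation]

theorem realize_of_mem {θ : memLang.Sentence} (h : θ ∈ ZFCWithoutFoundation) : M ⊨ θ :=
  Theory.realize_sentence_of_mem _ h

omit hM in
variable (M) in
theorem nonempty_of_model (h : M ⊨ ZFCWithoutFoundation) : Nonempty M := by
  obtain ⟨w, -⟩ := realize_infinity.1 (realize_of_mem (M := M) (by simp [ZFCWithoutFoundation]))
  exact ⟨w⟩

theorem ext_mem {x y : M} (h : ∀ z, z ε x ↔ z ε y) : x = y :=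
  realize_extensionality.1 (realize_of_mem (by simp [ZFCWithoutFoundation])) x y h

/-- The class `{x | P x}` is a set of `M`. -/
def IsSet (P : M → Prop) : Prop := ∃ b, ∀ x, x ε b ↔ P x

open Classical in
/-- The set `{x | P x}` of `M`; a meaningless value if this class is proper. -/
noncomputable def mkSet (P : M → Prop) : M :=
  if h : IsSet P then h.choose else
    (nonempty_of_model M hM).some

theorem mem_mkSet {P : M → Prop} (h : IsSet P) {x : M} : x ε mkSet P ↔ P x := by
  unfold mkSet
  rw [dif_pos h]
  exact h.choose_spec x

/-- Separation. -/
theorem IsSet.of_subset {P : M → Prop} (hP : FO₁ P) (a : M) (h : ∀ x, P x → x ε a) : IsSet P := by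
  obtain ⟨n, φ, p, hφ⟩ := hP.exists_formula
  obtain ⟨b, hb⟩ := (realize_separation φ).1
    (realize_of_mem (Or.inl (Or.inr ⟨n, φ, rfl⟩))) p a
  refine ⟨b, fun x => ?_⟩
  rw [hb, hφ]
  exact ⟨fun hx => hx.2, fun hx => ⟨h x hx, hx⟩⟩

/-- Replacement, for a definable functional relation. -/
theorem IsSet.replace {R : M → M → Prop} (hR : FO₂ R) (a : M)
    (h : ∀ x y z, x ε a → R x y → R x z → y = z) : IsSet (fun y => ∃ x, x ε a ∧ R x y) := by
  obtain ⟨n, φ, p, hφ⟩ := hR.exists_formula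
  obtain ⟨b, hb⟩ := (realize_replacement φ).1
    (realize_of_mem (Or.inr ⟨n, φ, rfl⟩)) p a (by simpa [hφ] using h)
  exact ⟨b, fun y => by simp [hb, hφ]⟩

theorem IsSet.image {F : M → M} (hF : DF₁ F) (a : M) : IsSet (fun y => ∃ x, x ε a ∧ y = F x) :=
  haveI := fun {α} {f : (α → M) → M} [DF f] => DF.app₁ hF (f := f)
  IsSet.replace inferInstance a (by rintro x y z - rfl rfl; rfl)

omit hM in
theorem IsSet.mem (a : M) : IsSet (fun x => x ε a) := ⟨a, fun _ => Iff.rfl⟩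

theorem IsSet.pair (x y : M) : IsSet (fun z => z = x ∨ z = y) :=
  realize_pairing.1 (realize_of_mem (by simp [ZFCWithoutFoundation])) x y

theorem IsSet.sUnion (a : M) : IsSet (fun z => ∃ y, y ε a ∧ z ε y) :=
  realize_union.1 (realize_of_mem (by simp [ZFCWithoutFoundation])) a

theorem IsSet.powerset (a : M) : IsSet (fun y => ∀ z, z ε y → z ε a) :=
  realize_powerSet.1 (realize_of_mem (by simp [ZFCWithoutFoundation])) a

theorem IsSet.or {P Q : M → Prop} (hP : IsSet P) (hQ : IsSet Q) : IsSet (fun x => P x ∨ Q x) := by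
  obtain ⟨a, ha⟩ := hP
  obtain ⟨b, hb⟩ := hQ
  obtain ⟨c, hc⟩ := IsSet.pair a b
  obtain ⟨e, he⟩ := IsSet.sUnion c
  exact ⟨e, fun x => by simp [he, hc, ← ha, ← hb]⟩

theorem IsSet.singleton (x : M) : IsSet (fun z => z = x) := by simpa using IsSet.pair x x

theorem IsSet.false : IsSet (fun _ : M => False) :=
  IsSet.of_subset inferInstance (nonempty_of_model M hM).some (by simp)

/-- A function whose values are sets with uniformly definable elements is definable. -/
theorem DF.of_mem {α : Type} {f : (α → M) → M} {Q : (α → M) → M → Prop}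
    (h : ∀ v x, x ε f v ↔ Q v x)
    (hQ : FO (fun w : α ⊕ Unit → M => Q (fun i => w (Sum.inl i)) (w (Sum.inr ())))) : DF f := by
  refine DF.of_graph ?_
  have hQ' : FO (fun w : (α ⊕ Unit) ⊕ Unit → M =>
      Q (fun i => w (Sum.inl (Sum.inl i))) (w (Sum.inr ()))) :=
    hQ.rename (Sum.elim (fun i => Sum.inl (Sum.inl i)) Sum.inr)
  refine FO.of_iff (Q := fun w => ∀ x, x ε w (Sum.inr ()) ↔ Q (fun i => w (Sum.inl i)) x) ?_
  intro w
  constructor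
  · rintro h' x
    rw [← h', h]
  · intro h'
    exact ext_mem fun z => by rw [h, h']

variable (M) in
/-- The empty set. -/
noncomputable def emp : M := mkSet (fun _ => False)

@[simp] theorem mem_emp {x : M} : x ε emp M ↔ False := mem_mkSet IsSet.false

/-- The unordered pair `{x, y}`. -/
noncomputable def upair (x y : M) : M := mkSet (fun z => z = x ∨ z = y)

@[simp] theorem mem_upair {x y z : M} : z ε upair x y ↔ z = x ∨ z = y := mem_mkSet (IsSet.pair x y)

instance {α : Type} {f g : (α → M) → M} [DF f] [DF g] : DF (fun v => upair (f v) (g v)) :=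
  DF.app₂ (DF.of_mem (fun _ _ => mem_upair) inferInstance)

/-- The Kuratowski pair `(x, y)`. -/
noncomputable def opair (x y : M) : M := upair (upair x x) (upair x y)

instance {α : Type} {f g : (α → M) → M} [DF f] [DF g] : DF (fun v => opair (f v) (g v)) := by
  unfold opair; infer_instance

theorem upair_inj_left {x y z : M} (h : upair x y = upair x z) : y = z := by
  have h1 : y ε upair x z := h ▸ mem_upair.2 (Or.inr rfl)
  have h2 : z ε upair x y := h ▸ mem_upair.2 (Or.inr rfl)
  simp only [mem_upair] at h1 h2
  grind

theorem opair_inj {x y x' y' : M} : opair x y = opair x' y' ↔ x = x' ∧ y = y' := by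
  refine ⟨fun h => ?_, fun ⟨h1, h2⟩ => h1 ▸ h2 ▸ rfl⟩
  have hx : x = x' := by
    have h1 : upair x x ε opair x' y' := h ▸ mem_upair.2 (Or.inl rfl)
    have h2 : x' ε upair x x := by
      rcases mem_upair.1 h1 with h | h <;> rw [h] <;> simp
    exact (or_self_iff.1 (mem_upair.1 h2)).symm
  subst hx
  exact ⟨rfl, upair_inj_left (upair_inj_left h)⟩

theorem isPair_iff {p x y : M} : IsPair p x y ↔ p = opair x y := by
  have h1 : ∀ t a b : M, (∀ s, s ε t ↔ s = a ∨ s = b) ↔ t = upair a b := fun t a b =>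
    ⟨fun h => ext_mem fun z => by rw [h, mem_upair], fun h s => by rw [h, mem_upair]⟩
  have h2 : ∀ t : M, (∀ s, s ε t ↔ s = x) ↔ t = upair x x := fun t => by simpa using h1 t x x
  unfold IsPair
  simp only [h1, h2]
  rfl

theorem app_iff {f x y : M} : App f x y ↔ opair x y ε f := by simp [App, isPair_iff]

/-- The graph of `F` restricted to `X`. -/
noncomputable def graphOn (F : M → M) (X : M) : M := mkSet (fun p => ∃ x, x ε X ∧ p = opair x (F x))

theorem mem_graphOn {F : M → M} (hF : DF₁ F) {X p : M} :
    p ε graphOn F X ↔ ∃ x, x ε X ∧ p = opair x (F x) :=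
  mem_mkSet (IsSet.image (F := fun x => opair x (F x)) inferInstance X)

theorem app_graphOn {F : M → M} (hF : DF₁ F) {X x y : M} :
    App (graphOn F X) x y ↔ x ε X ∧ y = F x := by
  rw [app_iff, mem_graphOn hF]
  simp only [opair_inj]
  constructor
  · rintro ⟨x, h, rfl, rfl⟩; exact ⟨h, rfl⟩
  · rintro ⟨h, rfl⟩; exact ⟨x, h, rfl, rfl⟩

theorem isFun_graphOn {F : M → M} (hF : DF₁ F) (X : M) : IsFun (graphOn F X) X := by
  refine ⟨fun p hp => ?_, fun x hx => ⟨F x, (app_graphOn hF).2 ⟨hx, rfl⟩, fun z hz =>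
    ((app_graphOn hF).1 hz).2⟩⟩
  obtain ⟨x, hx, rfl⟩ := (mem_graphOn hF).1 hp
  exact ⟨x, F x, hx, isPair_iff.2 rfl⟩

/-! ### The natural numbers of a model -/

/-- The successor `x ∪ {x}`. -/
noncomputable def succ (x : M) : M := mkSet (fun z => z ε x ∨ z = x)

@[simp] theorem mem_succ {x z : M} : z ε succ x ↔ z ε x ∨ z = x :=
  mem_mkSet ((IsSet.mem x).or (IsSet.singleton x))

instance {α : Type} {f : (α → M) → M} [DF f] : DF (fun v => succ (f v)) :=
  DF.app₁ (DF.of_mem (fun _ _ => mem_succ) inferInstance)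

/-- `w` contains the empty set and is closed under successors. -/
def Inductive (w : M) : Prop := emp M ε w ∧ ∀ x, x ε w → succ x ε w

theorem exists_inductive : ∃ w : M, Inductive w := by
  obtain ⟨w, ⟨e, he, he'⟩, hw⟩ :=
    realize_infinity.1 (realize_of_mem (M := M) (by simp [ZFCWithoutFoundation]))
  refine ⟨w, ?_, fun x hx => ?_⟩
  · rwa [show emp M = e from ext_mem fun z => by simp [he'] ]
  · obtain ⟨y, hy, hy'⟩ := hw x hx
    rwa [show succ x = y from ext_mem fun z => by simp [hy'] ]

/-- `x` is a natural number of `M`, that is, an element of every inductive set. -/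
def IsNat (x : M) : Prop := ∀ w, Inductive w → x ε w

instance {α : Type} {f : (α → M) → M} [DF f] : FO (fun v => IsNat (f v)) :=
  FO.app₁ (by unfold IsNat Inductive; infer_instance)

theorem isNat_emp : IsNat (emp M) := fun _ hw => hw.1

theorem IsNat.succ {x : M} (h : IsNat x) : IsNat (succ x) := fun w hw => hw.2 x (h w hw)

theorem isSet_isNat : IsSet (IsNat (M := M)) := by
  obtain ⟨w, hw⟩ := exists_inductive (M := M)
  exact IsSet.of_subset inferInstance w fun x hx => hx w hw

theorem IsNat.induction {P : M → Prop} (hP : FO₁ P) (h0 : P (emp M))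
    (hs : ∀ x, IsNat x → P x → P (DoubleMembership.succ x)) {x : M} (hx : IsNat x) : P x := by
  obtain ⟨w, hw⟩ := IsSet.of_subset (P := fun x : M => IsNat x ∧ P x)
    inferInstance (mkSet IsNat) (fun x hx => (mem_mkSet isSet_isNat).2 hx.1)
  refine ((hw x).1 (hx w ⟨(hw _).2 ⟨isNat_emp, h0⟩, fun y hy => ?_⟩)).2
  have := (hw y).1 hy
  exact (hw _).2 ⟨this.1.succ, hs y this.1 this.2⟩

theorem IsNat.transitive_and_not_mem_self {x : M} (hx : IsNat x) :
    (∀ y, y ε x → ∀ z, z ε y → z ε x) ∧ ¬ x ε x := by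
  refine IsNat.induction (P := fun x => (∀ y, y ε x → ∀ z, z ε y → z ε x) ∧ ¬ x ε x)
    inferInstance (by simp) ?_ hx
  rintro x - ⟨ht, hn⟩
  simp only [mem_succ]
  refine ⟨?_, ?_⟩
  · rintro y (hy | rfl) z hz
    · exact Or.inl (ht y hy z hz)
    · exact Or.inl hz
  · have hx : x ε DoubleMembership.succ x := mem_succ.2 (Or.inr rfl)
    rintro (h | h)
    · exact hn (ht _ h _ hx)
    · exact hn (by rwa [h] at hx)

theorem IsNat.succ_inj {x y : M} (hx : IsNat x)
    (h : DoubleMembership.succ x = DoubleMembership.succ y) : x = y := by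
  by_contra hne
  have h1 : x ε DoubleMembership.succ y := h ▸ mem_succ.2 (Or.inr rfl)
  have h2 : y ε DoubleMembership.succ x := h ▸ mem_succ.2 (Or.inr rfl)
  rw [mem_succ] at h1 h2
  obtain ⟨ht, hn⟩ := hx.transitive_and_not_mem_self
  exact hn (ht y (h2.resolve_right (Ne.symm hne)) x (h1.resolve_right hne))

theorem succ_ne_emp (x : M) : succ x ≠ emp M := fun h => by
  have : x ε succ x := mem_succ.2 (Or.inr rfl)
  simp [h] at this

end Sets

/-! ### Graphs realized by Anti-Foundation -/

section Graphs

variable {M : Type u} [memLang.Structure M] [hM : M ⊨ ZFCWithoutFoundation]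

/-- A set attached to `v` that marks the vertex for `v` in the flat system below. Both this set and
the element of it other than `∅` contain `∅`, which no vertex does. -/
noncomputable def marker (v : M) : M := upair (emp M) (upair (emp M) (upair v v))

instance {α : Type} {f : (α → M) → M} [DF f] : DF (fun v => marker (f v)) := by
  unfold marker; infer_instance

theorem marker_inj {v w : M} (h : marker v = marker w) : v = w := by
  have := upair_inj_left (upair_inj_left h)
  have h1 : v ε upair w w := this ▸ mem_upair.2 (Or.inl rfl)
  simpa using h1

theorem emp_mem_marker (v : M) : emp M ε marker v := mem_upair.2 (Or.inl rfl)

/-- Every symmetric definable graph on a set `V` of `M` is isomorphic to a union of connected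
components of the double-membership graph, provided that `∅` belongs to no vertex. -/
theorem exists_realization_of_graph (hA : M ⊨ antiFoundation) (V : M)
    (hV : ∀ v, v ε V → ¬ emp M ε v) {R : M → M → Prop} (hR : FO₂ R)
    (symm : ∀ v w, R v w → R w v) :
    ∃ f : M → M, (∀ v w, v ε V → w ε V → f v = f w → v = w) ∧
      ∀ v, v ε V → ∀ y, (f v ε y ∧ y ε f v) ↔ ∃ w, w ε V ∧ R v w ∧ y = f w := by
  have : ∀ {α : Type} {f g : (α → M) → M} [DF f] [DF g], FO (fun v => R (f v) (g v)) :=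
    fun {α f g} _ _ => FO.app₂ hR
  -- The equation for `v` lists the neighbours of `v`, which are indeterminates, and `marker v`,
  -- which is a constant.
  let S : M → M := fun v => mkSet (fun z => (z ε V ∧ R v z) ∨ z = marker v)
  have mem_S : ∀ v z, z ε S v ↔ (z ε V ∧ R v z) ∨ z = marker v := fun v z =>
    mem_mkSet ((IsSet.of_subset inferInstance V fun _ h => h.1).or (IsSet.singleton _))
  have hS : DF₁ S := DF.of_mem (fun v z => mem_S (v 0) z) inferInstance
  have marker_not_mem : ∀ v, ¬ marker v ε V := fun v h => hV _ h (emp_mem_marker v)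
  obtain ⟨f, ⟨hf, hsol⟩, -⟩ := realize_antiFoundation.1 hA V
    (mkSet (fun z => ∃ v, v ε V ∧ z = marker v)) (graphOn S V) (isFun_graphOn hS V) (by
      intro x s z hx hs hz
      obtain ⟨-, rfl⟩ := (app_graphOn hS).1 hs
      rcases (mem_S _ _).1 hz with h | h
      · exact Or.inl h.1
      · exact Or.inr ((mem_mkSet (IsSet.image inferInstance V)).2 ⟨x, hx, h⟩))
  -- `F` is the function of which the solution `f` is the graph, with arbitrary values outside `V`.
  have hF : ∀ v, ∃ y, v ε V → (App f v y ∧ ∀ z, App f v z → z = y) := fun v => by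
    by_cases h : v ε V
    · obtain ⟨y, hy⟩ := hf.2 v h
      exact ⟨y, fun _ => hy⟩
    · exact ⟨v, fun h' => absurd h' h⟩
  choose F hF using hF
  have app_F : ∀ {v z}, v ε V → (App f v z ↔ z = F v) := fun {v z} h =>
    ⟨(hF v h).2 z, fun e => e ▸ (hF v h).1⟩
  have mem_F : ∀ v, v ε V → ∀ z, z ε F v ↔ z = marker v ∨ ∃ w, w ε V ∧ R v w ∧ z = F w := by
    intro v hv z
    rw [hsol v (S v) (F v) hv ((app_graphOn hS).2 ⟨hv, rfl⟩) (hF v hv).1 z]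
    constructor
    · rintro (⟨h1, h2⟩ | ⟨y, ⟨h1, h2⟩, h3⟩)
      · exact Or.inl (((mem_S _ _).1 h1).resolve_left fun h => h2 h.1)
      · rcases (mem_S _ _).1 h1 with h | rfl
        · exact Or.inr ⟨y, h2, h.2, (app_F h2).1 h3⟩
        · exact absurd h2 (marker_not_mem v)
    · rintro (rfl | ⟨w, hw, hvw, rfl⟩)
      · exact Or.inl ⟨(mem_S _ _).2 (Or.inr rfl), marker_not_mem v⟩
      · exact Or.inr ⟨w, ⟨(mem_S _ _).2 (Or.inl ⟨hw, hvw⟩), hw⟩, (hF w hw).1⟩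
  have marker_mem : ∀ v, v ε V → marker v ε F v := fun v hv => (mem_F v hv _).2 (Or.inl rfl)
  have ne_emp : ∀ v, v ε V → F v ≠ emp M := fun v hv h => by
    have := marker_mem v hv
    simp [h] at this
  have emp_not_mem : ∀ v, v ε V → ¬ emp M ε F v := fun v hv h => by
    rcases (mem_F v hv _).1 h with h | ⟨w, hw, -, h⟩
    · have := emp_mem_marker v
      simp [← h] at this
    · exact ne_emp w hw h.symm
  refine ⟨F, fun v w hv hw h => ?_, fun v hv y => ⟨?_, ?_⟩⟩
  -- If `f v = f w`, then `marker v ∈ f w`, and it contains `∅`, so it is the marker of `w`.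
  · have h1 := marker_mem v hv
    rw [h] at h1
    rcases (mem_F w hw _).1 h1 with h2 | ⟨w', hw', -, h2⟩
    · exact marker_inj h2
    · exact absurd (h2 ▸ emp_mem_marker v) (emp_not_mem w' hw')
  -- The elements of a marker are `∅` and a set that contains `∅`, so no `f v` is one of them.
  · rintro ⟨h1, h2⟩
    rcases (mem_F v hv y).1 h2 with rfl | h
    · rcases mem_upair.1 h1 with h | h
      · exact absurd h (ne_emp v hv)
      · exact absurd (h ▸ mem_upair.2 (Or.inl rfl)) (emp_not_mem v hv)
    · exact h
  · rintro ⟨w, hw, hvw, rfl⟩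
    exact ⟨(mem_F w hw _).2 (Or.inr ⟨v, hv, symm v w hvw, rfl⟩),
      (mem_F v hv _).2 (Or.inr ⟨w, hw, hvw, rfl⟩)⟩

end Graphs

/-! ### Levels of the cumulative hierarchy -/

section Levels

variable {M : Type u} [memLang.Structure M]

/-- `x` is a subset of `y`. -/
def Sub (x y : M) : Prop := ∀ z, z ε x → z ε y

instance {α : Type} {f g : (α → M) → M} [DF f] [DF g] : FO (fun v => Sub (f v) (g v)) :=
  FO.app₂ (by unfold Sub; infer_instance)

/-- `s` contains all subsets of its elements. -/
def Potent (s : M) : Prop := ∀ x c, Sub x c → c ε s → x ε s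

/-- A history is a set `h` such that every `x ∈ h` is the set of all subsets of elements of
`x ∩ h`. -/
def IsHistory (h : M) : Prop :=
  ∀ x, x ε h → ∀ z, z ε x ↔ ∃ c, c ε x ∧ c ε h ∧ Sub z c

/-- A level of the cumulative hierarchy: the set of all subsets of elements of a history. Levels are
the sets `V_α` of the model, described without mentioning ordinals. -/
def IsLevel (s : M) : Prop :=
  ∃ h, IsHistory h ∧ ∀ z, z ε s ↔ ∃ c, c ε h ∧ Sub z c

instance {α : Type} {f : (α → M) → M} [DF f] : FO (fun v => IsLevel (f v)) :=
  FO.app₁ (by unfold IsLevel IsHistory; infer_instance)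

theorem Sub.refl (x : M) : Sub x x := fun _ h => h

theorem Sub.trans {x y z : M} (h : Sub x y) (h' : Sub y z) : Sub x z := fun t ht => h' t (h t ht)

theorem IsHistory.potent {h x : M} (hh : IsHistory h) (hx : x ε h) : Potent x := by
  intro y c hy hc
  obtain ⟨e, h1, h2, h3⟩ := (hh x hx c).1 hc
  exact (hh x hx y).2 ⟨e, h1, h2, hy.trans h3⟩

theorem IsLevel.potent {s : M} (hs : IsLevel s) : Potent s := by
  obtain ⟨h, hh, hs⟩ := hs
  intro y c hy hc
  obtain ⟨e, h1, h2⟩ := (hs c).1 hc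
  exact (hs y).2 ⟨e, h1, hy.trans h2⟩

theorem IsLevel.sub_of_mem {s x : M} (hs : IsLevel s) (hx : x ε s) : Sub x s := by
  obtain ⟨h, hh, hs⟩ := hs
  obtain ⟨c, hc, hxc⟩ := (hs x).1 hx
  intro z hz
  obtain ⟨e, -, h2, h3⟩ := (hh c hc z).1 (hxc z hz)
  exact (hs z).2 ⟨e, h2, h3⟩

variable [hM : M ⊨ ZFCWithoutFoundation]

/-- Without Foundation, a non-empty class of sets closed under subsets of elements still has an
`∈`-minimal member: otherwise Russell's set, formed in the intersection of the class, would be an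
element of that intersection. -/
theorem exists_minimal_of_potent {P : M → Prop} (hP : FO₁ P) (hpot : ∀ s, P s → Potent s)
    (hne : ∃ s, P s) : ∃ s, P s ∧ ∀ r, P r → ¬ r ε s := by
  by_contra! hcon
  obtain ⟨a, ha⟩ := hne
  have : ∀ {α : Type} {f : (α → M) → M} [DF f], FO (fun v => P (f v)) :=
    fun {α f} _ => FO.app₁ hP
  -- The Russell set of the intersection of the class, which is a set because it is part of `a`.
  obtain ⟨d, hd⟩ := IsSet.of_subset (P := fun x : M => (∀ s, P s → x ε s) ∧ ¬ x ε x)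
    inferInstance a (fun x hx => hx.1 a ha)
  have key : ∀ s, P s → d ε s := fun s hs => by
    obtain ⟨r, hr, hrs⟩ := hcon s hs
    exact hpot s hs d r (fun z hz => ((hd z).1 hz).1 r hr) hrs
  by_cases h : d ε d
  · exact ((hd d).1 h).2 h
  · exact h ((hd d).2 ⟨key, h⟩)

/-- An `∈`-minimal element `x` of a history `h` that is not a level would have `x ∩ h` as a
history. -/
theorem IsHistory.isLevel_of_mem {h x : M} (hh : IsHistory h) (hx : x ε h) : IsLevel x := by
  by_contra hxl
  obtain ⟨x, ⟨hx, hxl⟩, hmin⟩ := exists_minimal_of_potent (P := fun x : M => x ε h ∧ ¬ IsLevel x)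
    inferInstance (fun s hs => hh.potent hs.1) ⟨x, hx, hxl⟩
  have hlev : ∀ y, y ε x → y ε h → IsLevel y := fun y hy hyh => by
    by_contra hyl
    exact hmin y ⟨hyh, hyl⟩ hy
  obtain ⟨k, hk⟩ := IsSet.of_subset (P := fun y : M => y ε x ∧ y ε h) inferInstance h
    (fun y hy => hy.2)
  refine hxl ⟨k, fun y hy z => ?_, fun z => ?_⟩
  · obtain ⟨hyx, hyh⟩ := (hk y).1 hy
    rw [hh y hyh]
    refine exists_congr fun c => ?_
    rw [hk]
    have : c ε y → c ε x := fun hc =>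
      (hh x hx c).2 ⟨y, hyx, hyh, (hlev y hyx hyh).sub_of_mem hc⟩
    tauto
  · rw [hh x hx]
    simp only [hk, and_assoc]

theorem IsLevel.mem_iff {s z : M} (hs : IsLevel s) :
    z ε s ↔ ∃ r, IsLevel r ∧ r ε s ∧ Sub z r := by
  constructor
  · obtain ⟨h, hh, hs⟩ := hs
    intro hz
    obtain ⟨c, hc, hzc⟩ := (hs z).1 hz
    exact ⟨c, hh.isLevel_of_mem hc, (hs c).2 ⟨c, hc, Sub.refl c⟩, hzc⟩
  · rintro ⟨r, -, hr, hzr⟩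
    exact hs.potent z r hzr hr

theorem IsLevel.ext {s t : M} (hs : IsLevel s) (ht : IsLevel t)
    (h : ∀ r, IsLevel r → (r ε s ↔ r ε t)) : s = t := by
  refine ext_mem fun z => ?_
  rw [hs.mem_iff, ht.mem_iff]
  refine exists_congr fun r => and_congr_right fun hr => ?_
  rw [h r hr]

theorem IsLevel.not_mem_self {s : M} (hs : IsLevel s) : ¬ s ε s := by
  obtain ⟨r, rfl, h⟩ := exists_minimal_of_potent (P := fun x => x = s) inferInstance
    (fun r hr => hr ▸ hs.potent) ⟨s, rfl⟩
  exact h r rfl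

/-- Levels are linearly ordered by membership: among the incomparable pairs `(s, t)`, choose first
`s` and then `t` minimal; then `s` and `t` contain the same levels, so they are equal. -/
theorem IsLevel.trichotomy {s t : M} (hs : IsLevel s) (ht : IsLevel t) :
    s ε t ∨ s = t ∨ t ε s := by
  by_contra hcon
  obtain ⟨s, ⟨hs, t, ht, hcon⟩, hmin⟩ := exists_minimal_of_potent
    (P := fun s : M => IsLevel s ∧ ∃ t, IsLevel t ∧ ¬ (s ε t ∨ s = t ∨ t ε s)) inferInstance
    (fun s hs => hs.1.potent) ⟨s, hs, t, ht, hcon⟩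
  obtain ⟨t, ⟨ht, hcon⟩, hmin'⟩ := exists_minimal_of_potent
    (P := fun t : M => IsLevel t ∧ ¬ (s ε t ∨ s = t ∨ t ε s)) inferInstance
    (fun s hs => hs.1.potent) ⟨t, ht, hcon⟩
  refine hcon (Or.inr (Or.inl (hs.ext ht fun r hr => ⟨fun h => ?_, fun h => ?_⟩)))
  · by_contra hrt
    refine hmin r ⟨hr, t, ht, ?_⟩ h
    rintro (h1 | rfl | h1)
    · exact hrt h1
    · exact hcon (Or.inr (Or.inr h))
    · exact hcon (Or.inr (Or.inr (hs.sub_of_mem h t h1)))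
  · by_contra hrs
    refine hmin' r ⟨hr, ?_⟩ h
    rintro (h1 | rfl | h1)
    · exact hcon (Or.inl (ht.sub_of_mem h s h1))
    · exact hcon (Or.inl h)
    · exact hrs h1

/-- Every set of levels is bounded by a level. -/
theorem exists_level_of_isSet {P : M → Prop} (hP : FO₁ P) (hset : IsSet P)
    (hlev : ∀ s, P s → IsLevel s) : ∃ t, IsLevel t ∧ ∀ s, P s → s ε t := by
  have : ∀ {α : Type} {f : (α → M) → M} [DF f], FO (fun v => P (f v)) :=
    fun {α f} _ => FO.app₁ hP
  obtain ⟨a, ha⟩ := hset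
  obtain ⟨b, hb⟩ := (IsSet.sUnion a).or (IsSet.mem a)
  -- The levels up to those in the given set form a history.
  obtain ⟨h, hh⟩ := IsSet.of_subset (P := fun r : M => IsLevel r ∧ ∃ s, P s ∧ (r ε s ∨ r = s))
    inferInstance b (by
      rintro r ⟨-, s, hs, h | rfl⟩
      · exact (hb r).2 (Or.inl ⟨s, (ha s).2 hs, h⟩)
      · exact (hb r).2 (Or.inr ((ha r).2 hs)))
  have hhist : IsHistory h := by
    intro r hr z
    obtain ⟨hrl, s, hs, hrs⟩ := (hh r).1 hr
    constructor
    · intro hz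
      obtain ⟨c, hcl, hc, hzc⟩ := hrl.mem_iff.1 hz
      refine ⟨c, hc, (hh c).2 ⟨hcl, s, hs, Or.inl ?_⟩, hzc⟩
      rcases hrs with hrs | rfl
      · exact (hlev s hs).sub_of_mem hrs c hc
      · exact hc
    · rintro ⟨c, hc, -, hzc⟩
      exact hrl.potent z c hzc hc
  obtain ⟨p, hp⟩ := IsSet.powerset (mkSet (fun z => ∃ y, y ε h ∧ z ε y))
  obtain ⟨t, ht⟩ := IsSet.of_subset (P := fun z : M => ∃ c, c ε h ∧ Sub z c) inferInstance p (by
    rintro z ⟨c, hc, hzc⟩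
    exact (hp z).2 fun x hx => (mem_mkSet (IsSet.sUnion h)).2 ⟨c, hc, hzc x hx⟩)
  exact ⟨t, ⟨h, hhist, ht⟩, fun s hs =>
    (ht s).2 ⟨s, (hh s).2 ⟨hlev s hs, s, hs, Or.inr rfl⟩, Sub.refl s⟩⟩

/-- Every level is an element of another one. -/
theorem IsLevel.exists_mem {s : M} (hs : IsLevel s) : ∃ t, IsLevel t ∧ s ε t := by
  obtain ⟨t, ht, h⟩ := exists_level_of_isSet (P := fun x => x = s) inferInstance
    (IsSet.singleton s) (fun r hr => hr ▸ hs)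
  exact ⟨t, ht, h s rfl⟩

/-- The well-founded part of the model: the union of its levels. -/
def WF (x : M) : Prop := ∃ s, IsLevel s ∧ x ε s

instance {α : Type} {f : (α → M) → M} [DF f] : FO (fun v => WF (f v)) :=
  FO.app₁ (by unfold WF; infer_instance)

omit hM in
theorem WF.of_mem {x y : M} (hy : WF y) (h : x ε y) : WF x := by
  obtain ⟨s, hs, hys⟩ := hy
  exact ⟨s, hs, hs.sub_of_mem hys x h⟩

omit hM in
theorem WF.of_sub {x y : M} (hy : WF y) (h : Sub x y) : WF x := by
  obtain ⟨s, hs, hys⟩ := hy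
  exact ⟨s, hs, hs.potent x y h hys⟩

/-- A non-empty definable class of levels has a least member. -/
theorem exists_least_level {P : M → Prop} (hP : FO₁ P) (hlev : ∀ s, P s → IsLevel s)
    (hne : ∃ s, P s) : ∃ s, P s ∧ ∀ r, P r → s ε r ∨ s = r := by
  obtain ⟨s, hs, hmin⟩ := exists_minimal_of_potent hP (fun s hs => (hlev s hs).potent) hne
  refine ⟨s, hs, fun r hr => ?_⟩
  rcases (hlev s hs).trichotomy (hlev r hr) with h | h | h
  · exact Or.inl h
  · exact Or.inr h
  · exact absurd h (hmin r hr)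

/-- Collection for levels: replacement is applied to the function that takes `x` to the least
level `s` with `R x s`. -/
theorem exists_level_collection {R : M → M → Prop} (hR : FO₂ R) (a : M)
    (h : ∀ x, x ε a → ∃ s, IsLevel s ∧ R x s) :
    ∃ t, IsLevel t ∧ ∀ x, x ε a → ∃ s, IsLevel s ∧ R x s ∧ s ε t := by
  have : ∀ {α : Type} {f g : (α → M) → M} [DF f] [DF g], FO (fun v => R (f v) (g v)) :=
    fun {α f g} _ _ => FO.app₂ hR
  let Q : M → M → Prop := fun x s =>
    (IsLevel s ∧ R x s) ∧ ∀ r, IsLevel r ∧ R x r → s ε r ∨ s = r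
  have hQ : FO₂ Q := by unfold Q; infer_instance
  have : ∀ {α : Type} {f g : (α → M) → M} [DF f] [DF g], FO (fun v => Q (f v) (g v)) :=
    fun {α f g} _ _ => FO.app₂ hQ
  obtain ⟨t, ht, h'⟩ := exists_level_of_isSet (P := fun s : M => ∃ x, x ε a ∧ Q x s) inferInstance
    (IsSet.replace hQ a (by
      rintro x y z - ⟨hy, hy'⟩ ⟨hz, hz'⟩
      rcases hy' z hz with h1 | h1
      · rcases hz' y hy with h2 | h2
        · exact absurd (hy.1.sub_of_mem h2 y h1) hy.1.not_mem_self
        · exact h2.symm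
      · exact h1)) (by rintro s ⟨x, -, hs⟩; exact hs.1.1)
  refine ⟨t, ht, fun x hx => ?_⟩
  obtain ⟨s, hs, hs'⟩ := exists_least_level (P := fun s : M => IsLevel s ∧ R x s) inferInstance
    (fun s hs => hs.1) (h x hx)
  exact ⟨s, hs.1, hs.2, h' s ⟨x, hx, hs, hs'⟩⟩

/-- A set of well-founded sets is well-founded. -/
theorem WF.of_forall {x : M} (h : ∀ z, z ε x → WF z) : WF x := by
  obtain ⟨t, ht, h'⟩ := exists_level_collection (R := fun z s : M => z ε s) inferInstance x h
  obtain ⟨t', ht', htt'⟩ := ht.exists_mem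
  refine ⟨t', ht', ht'.potent x t (fun z hz => ?_) htt'⟩
  obtain ⟨s, -, hzs, hst⟩ := h' z hz
  exact ht.sub_of_mem hst z hzs

/-- An element of `x` in the least level that meets `x` is disjoint from `x`. -/
theorem WF.foundation {x : M} (h : ∀ z, z ε x → WF z) (hne : ∃ y, y ε x) :
    ∃ y, y ε x ∧ ∀ z, z ε x → ¬ z ε y := by
  obtain ⟨s, ⟨hs, y, hy, hys⟩, hmin⟩ := exists_least_level
    (P := fun s : M => IsLevel s ∧ ∃ y, y ε x ∧ y ε s) inferInstance (fun s hs => hs.1) (by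
      obtain ⟨y, hy⟩ := hne
      obtain ⟨s, hs, hys⟩ := h y hy
      exact ⟨s, hs, y, hy, hys⟩)
  refine ⟨y, hy, fun z hz hzy => ?_⟩
  obtain ⟨r, hr, hrs, hyr⟩ := hs.mem_iff.1 hys
  rcases hmin r ⟨hr, z, hz, hyr z hzy⟩ with h1 | rfl
  · exact hs.not_mem_self (hs.sub_of_mem hrs s h1)
  · exact hs.not_mem_self hrs

theorem wf_emp : WF (emp M) := WF.of_forall (by simp)

end Levels

/-! ### The well-founded part is a model of `ZFC` -/

section Classes

variable {M : Type u} [memLang.Structure M]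

/-- A class of a structure for the language of set theory, with the induced membership. -/
instance classStructure (D : M → Prop) : memLang.Structure {x // D x} where
  funMap f := Empty.elim f
  RelMap R x := Structure.RelMap R (fun i => (x i : M))

theorem coe_mem {D : M → Prop} {x y : {x // D x}} : x ε y ↔ (x : M) ε (y : M) := by
  refine Iff.of_eq (congrArg (Structure.RelMap (M := M) memSym) ?_)
  ext i
  fin_cases i <;> rfl

theorem coe_realize_term {D : M → Prop} {α : Type} (t : memLang.Term α) (v : α → {x // D x}) :
    ((t.realize v : {x // D x}) : M) = t.realize (fun i => (v i : M)) := by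
  cases t with
  | var i => rfl
  | func f _ => exact Empty.elim f

/-- Satisfaction of a formula with all quantifiers relativized to the class `D`. -/
def relSat (D : M → Prop) {α : Type} :
    ∀ {n : ℕ}, memLang.BoundedFormula α n → (α → M) → (Fin n → M) → Prop
  | _, .falsum, _, _ => False
  | _, .equal t₁ t₂, v, xs => t₁.realize (Sum.elim v xs) = t₂.realize (Sum.elim v xs)
  | _, .rel R ts, v, xs => Structure.RelMap R (fun i => (ts i).realize (Sum.elim v xs))
  | _, .imp φ ψ, v, xs => relSat D φ v xs → relSat D ψ v xs
  | _, .all φ, v, xs => ∀ x, D x → relSat D φ v (Fin.snoc xs x)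

/-- Truth in a class is truth of the relativized formula. -/
theorem realize_class_iff {D : M → Prop} {α : Type} {n : ℕ} (φ : memLang.BoundedFormula α n)
    (v : α → {x // D x}) (xs : Fin n → {x // D x}) :
    φ.Realize v xs ↔ relSat D φ (fun i => (v i : M)) (fun i => (xs i : M)) := by
  have hv : ∀ {n : ℕ} (xs : Fin n → {x // D x}), (fun i => ((Sum.elim v xs i : {x // D x}) : M)) =
      Sum.elim (fun i => (v i : M)) (fun i => (xs i : M)) := by
    intro n xs
    ext (i | i) <;> rfl
  induction φ with
  | falsum => exact Iff.rfl
  | equal t₁ t₂ =>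
    rw [BoundedFormula.Realize, relSat, ← Subtype.coe_inj, coe_realize_term, coe_realize_term, hv]
  | rel R ts =>
    rw [BoundedFormula.Realize, relSat, ← hv]
    simp only [← coe_realize_term]
    exact Iff.rfl
  | imp φ ψ ih₁ ih₂ => simp only [BoundedFormula.realize_imp, relSat, ih₁, ih₂]
  | all φ ih =>
    simp only [BoundedFormula.realize_all, relSat, ih, Subtype.forall]
    refine forall_congr' fun x => forall_congr' fun hx => Iff.of_eq (congrArg _ ?_)
    ext i
    refine Fin.lastCases ?_ (fun i => ?_) i <;> simp

/-- Relativized satisfaction in a definable class is definable, for each single formula. -/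
theorem FO.relSat {D : M → Prop} (hD : FO₁ D) {α : Type} {n : ℕ} (φ : memLang.BoundedFormula α n) :
    FO (fun w : α ⊕ Fin n → M =>
      relSat D φ (fun i => w (Sum.inl i)) (fun i => w (Sum.inr i))) := by
  have hw : ∀ {n : ℕ} (w : α ⊕ Fin n → M),
      Sum.elim (fun i => w (Sum.inl i)) (fun i => w (Sum.inr i)) = w := fun w => by
    ext (i | i) <;> rfl
  have hterm : ∀ {n : ℕ} (t : memLang.Term (α ⊕ Fin n)), DF (fun w : α ⊕ Fin n → M => t.realize w) :=
    fun t => by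
      cases t with
      | var i => exact DF.proj i
      | func f _ => exact Empty.elim f
  induction φ with
  | falsum => exact FO.false
  | equal t₁ t₂ =>
    simp only [DoubleMembership.relSat, hw]
    have := hterm t₁
    have := hterm t₂
    infer_instance
  | rel R ts =>
    simp only [DoubleMembership.relSat, hw]
    cases R
    have := hterm (ts 0)
    have := hterm (ts 1)
    refine FO.of_iff (Q := fun w => (ts 0).realize w ε (ts 1).realize w) fun w => ?_
    refine Iff.of_eq (congrArg (Structure.RelMap (M := M) memSym) ?_)
    ext i
    fin_cases i <;> rfl
  | imp φ ψ ih₁ ih₂ => exact FO.imp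
  | @all n φ ih =>
    have hφ := ih.rename (α := (α ⊕ Fin n) ⊕ Unit)
      (Sum.elim (fun i => Sum.inl (Sum.inl i))
        (Fin.snoc (α := fun _ => (α ⊕ Fin n) ⊕ Unit) (fun i => Sum.inl (Sum.inr i)) (Sum.inr ())))
    have hD' : FO (fun w : (α ⊕ Fin n) ⊕ Unit → M => D (w (Sum.inr ()))) := FO.app₁ hD
    have : FO (fun w : (α ⊕ Fin n) ⊕ Unit → M => DoubleMembership.relSat D φ
        (fun i => w (Sum.inl (Sum.inl i)))
        (Fin.snoc (fun i => w (Sum.inl (Sum.inr i))) (w (Sum.inr ())))) := by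
      refine FO.of_iff (hQ := hφ) fun w => Iff.of_eq (congrArg _ ?_)
      ext i
      refine Fin.lastCases ?_ (fun i => ?_) i <;> simp
    exact FO.forall

variable [hM : M ⊨ ZFCWithoutFoundation]

/-- The well-founded part of a model of `ZFC` without Foundation is a model of `ZFC`. -/
theorem WF.models_ZFC : {x : M // WF x} ⊨ ZFC := by
  -- A set of well-founded sets is itself an element of the class. So every axiom reduces to the
  -- existence in `M` of a set of well-founded sets.
  have sub : ∀ {P : M → Prop}, IsSet P → (∀ x, P x → WF x) →
      ∃ b : {x : M // WF x}, ∀ x : M, x ε (b : M) ↔ P x := by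
    rintro P ⟨b, hb⟩ hP
    exact ⟨⟨b, WF.of_forall fun z hz => hP z ((hb z).1 hz)⟩, hb⟩
  have hWF : FO₁ (WF (M := M)) := inferInstance
  refine (Theory.model_iff _).2 ?_
  rintro θ ((((rfl | rfl | rfl | rfl | rfl | rfl) | ⟨n, φ, rfl⟩) | ⟨n, φ, rfl⟩) | rfl)
  · rw [realize_extensionality]
    intro x y h
    refine Subtype.ext (ext_mem fun z => ⟨fun hz => ?_, fun hz => ?_⟩)
    · exact coe_mem.1 ((h ⟨z, x.2.of_mem hz⟩).1 (coe_mem.2 hz))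
    · exact coe_mem.1 ((h ⟨z, y.2.of_mem hz⟩).2 (coe_mem.2 hz))
  · rw [realize_pairing]
    intro x y
    obtain ⟨b, hb⟩ := sub (IsSet.pair (x : M) y) (by rintro z (rfl | rfl) <;> exact Subtype.prop _)
    exact ⟨b, fun t => by simp only [coe_mem, hb, Subtype.ext_iff]⟩
  · rw [realize_union]
    intro x
    obtain ⟨b, hb⟩ := sub (IsSet.sUnion (x : M)) (by
      rintro z ⟨y, hy, hz⟩
      exact (x.2.of_mem hy).of_mem hz)
    refine ⟨b, fun z => ?_⟩
    simp only [coe_mem, hb]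
    exact ⟨fun ⟨y, h⟩ => ⟨⟨y, x.2.of_mem h.1⟩, h⟩, fun ⟨y, h⟩ => ⟨y, h⟩⟩
  · rw [realize_powerSet]
    intro x
    obtain ⟨b, hb⟩ := sub (IsSet.powerset (x : M)) (fun y hy => x.2.of_sub hy)
    refine ⟨b, fun y => ?_⟩
    simp only [coe_mem, hb]
    exact ⟨fun h z hz => h z hz, fun h z hz => h ⟨z, y.2.of_mem hz⟩ hz⟩
  · rw [realize_infinity]
    have nat_wf : ∀ x : M, IsNat x → WF x := fun x hx =>
      IsNat.induction hWF wf_emp (fun x _ h => WF.of_forall fun z hz => by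
        rcases mem_succ.1 hz with hz | rfl
        · exact h.of_mem hz
        · exact h) hx
    obtain ⟨b, hb⟩ := sub isSet_isNat nat_wf
    refine ⟨b, ⟨⟨emp M, wf_emp⟩, coe_mem.2 ((hb _).2 isNat_emp), fun z hz => ?_⟩, fun x hx => ?_⟩
    · exact mem_emp.1 (coe_mem.1 hz)
    · have := ((hb x).1 (coe_mem.1 hx)).succ
      refine ⟨⟨_, nat_wf _ this⟩, coe_mem.2 ((hb _).2 this), fun z => ?_⟩
      simp only [coe_mem, mem_succ, Subtype.ext_iff]
  · rw [realize_choice]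
    intro F h1 h2
    obtain ⟨c, hc⟩ := realize_choice.1
      (realize_of_mem (M := M) (by simp [ZFCWithoutFoundation])) (F : M)
      (fun x hx => by
        obtain ⟨y, hy⟩ := h1 ⟨x, F.2.of_mem hx⟩ (coe_mem.2 hx)
        exact ⟨y, coe_mem.1 hy⟩)
      (fun x y z hx hy hzx hzy => congrArg Subtype.val
        (h2 ⟨x, F.2.of_mem hx⟩ ⟨y, F.2.of_mem hy⟩ ⟨z, (F.2.of_mem hx).of_mem hzx⟩
          (coe_mem.2 hx) (coe_mem.2 hy) (coe_mem.2 hzx) (coe_mem.2 hzy)))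
    obtain ⟨b, hb⟩ := sub (IsSet.of_subset (P := fun z : M => z ε c ∧ WF z) inferInstance c
      fun z hz => hz.1) (fun z hz => hz.2)
    refine ⟨b, fun x hx => ?_⟩
    obtain ⟨y, ⟨hyx, hyc⟩, hy⟩ := hc x (coe_mem.1 hx)
    refine ⟨⟨y, x.2.of_mem hyx⟩, ⟨coe_mem.2 hyx, coe_mem.2 ((hb _).2 ⟨hyc, x.2.of_mem hyx⟩)⟩, ?_⟩
    intro z hzx hzb
    exact Subtype.ext (hy z (coe_mem.1 hzx) ((hb _).1 (coe_mem.1 hzb)).1)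
  · rw [realize_separation]
    intro p a
    have hφ := (FO.relSat hWF φ).subst (α := Fin 1)
      (Sum.elim (Sum.elim (fun i _ => (p i : M)) (fun _ v => v 0)) finZeroElim) (by
        rintro ((i | i) | i)
        · exact DF.const _
        · exact DF.proj _
        · exact i.elim0)
    obtain ⟨b, hb⟩ := sub (IsSet.of_subset
      (P := fun x : M => x ε (a : M) ∧ relSat WF φ (Sum.elim (fun i => (p i : M)) ![x]) default)
      (FO.and (hQ := FO.of_iff (hQ := hφ) (by
        intro v
        refine Iff.of_eq (congrArg₂ _ ?_ (Subsingleton.elim _ _))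
        ext (i | i)
        · rfl
        · fin_cases i; rfl))) (a : M) fun z hz => hz.1) (fun z hz => a.2.of_mem hz.1)
    refine ⟨b, fun x => ?_⟩
    rw [coe_mem, hb, coe_mem, Formula.Realize, realize_class_iff]
    refine and_congr_right fun _ => Iff.of_eq (congrArg₂ _ ?_ (Subsingleton.elim _ _))
    ext (i | i)
    · rfl
    · fin_cases i; rfl
  · rw [realize_replacement]
    intro p a hfun
    have hφ := (FO.relSat hWF φ).subst (α := Fin 2)
      (Sum.elim (Sum.elim (fun i _ => (p i : M)) (fun j v => v j)) finZeroElim) (by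
        rintro ((i | i) | i)
        · exact DF.const _
        · exact DF.proj _
        · exact i.elim0)
    let Q : M → M → Prop := fun x y => WF y ∧
      relSat WF φ (Sum.elim (fun i => (p i : M)) ![x, y]) default
    have hQ : FO₂ Q := FO.and (hQ := FO.of_iff (hQ := hφ) (by
        intro v
        refine Iff.of_eq (congrArg₂ _ ?_ (Subsingleton.elim _ _))
        ext (i | i)
        · rfl
        · fin_cases i <;> rfl))
    have hQφ : ∀ x y : {x : M // WF x}, Q x y ↔ φ.Realize (Sum.elim p ![x, y]) := by
      intro x y
      rw [Formula.Realize, realize_class_iff, show Q x y ↔ _ from and_iff_right y.2]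
      refine Iff.of_eq (congrArg₂ _ ?_ (Subsingleton.elim _ _))
      ext (i | i)
      · rfl
      · fin_cases i <;> rfl
    obtain ⟨b, hb⟩ := sub (IsSet.replace hQ (a : M) (by
      intro x y z hx hy hz
      have := hfun ⟨x, a.2.of_mem hx⟩ ⟨y, hy.1⟩ ⟨z, hz.1⟩ (coe_mem.2 hx)
        ((hQφ _ _).1 hy) ((hQφ _ _).1 hz)
      exact congrArg Subtype.val this)) (by rintro y ⟨x, -, hy⟩; exact hy.1)
    refine ⟨b, fun y => ?_⟩
    rw [coe_mem, hb]
    constructor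
    · rintro ⟨x, hx, hxy⟩
      exact ⟨⟨x, a.2.of_mem hx⟩, coe_mem.2 hx, (hQφ ⟨x, a.2.of_mem hx⟩ y).1 hxy⟩
    · rintro ⟨x, hx, hxy⟩
      exact ⟨x, coe_mem.1 hx, (hQφ x y).2 hxy⟩
  · rw [realize_foundation]
    rintro x ⟨y, hy⟩
    obtain ⟨z, hz, h⟩ := WF.foundation (x := (x : M)) (fun z hz => x.2.of_mem hz)
      ⟨y, coe_mem.1 hy⟩
    exact ⟨⟨z, x.2.of_mem hz⟩, coe_mem.2 hz, fun w hw hwz => h w (coe_mem.1 hw) (coe_mem.1 hwz)⟩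

end Classes

/-! ### Reflection -/

section Reflection

variable {M : Type u} [memLang.Structure M]

/-- The level `s` is not the first one, and cofinally many levels `r'` in `s` have a level `t` in
`s` with `P r' t`. Asking for this only cofinally makes the property easy to obtain for limits of
sequences; it suffices for reflection. -/
def ClosedLevel (P : M → M → Prop) (s : M) : Prop :=
  (∃ r, IsLevel r ∧ r ε s) ∧ ∀ r, IsLevel r → r ε s →
    ∃ r' t, IsLevel r' ∧ r' ε s ∧ r ε r' ∧ IsLevel t ∧ t ε s ∧ P r' t

/-- For every level `r`, the relation `P r t` holds for all levels `t` above some bound. -/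
def Bounding (P : M → M → Prop) : Prop :=
  ∀ r, IsLevel r → ∃ t, IsLevel t ∧ ∀ t', IsLevel t' → Sub t t' → P r t'

theorem ClosedLevel.mono {P Q : M → M → Prop} {s : M} (h : ∀ r t, P r t → Q r t)
    (hs : ClosedLevel P s) : ClosedLevel Q s := by
  refine ⟨hs.1, fun r hr hrs => ?_⟩
  obtain ⟨r', t, h1, h2, h3, h4, h5, h6⟩ := hs.2 r hr hrs
  exact ⟨r', t, h1, h2, h3, h4, h5, h _ _ h6⟩

variable [hM : M ⊨ ZFCWithoutFoundation]

theorem IsLevel.sub_total {s t : M} (hs : IsLevel s) (ht : IsLevel t) : Sub s t ∨ Sub t s := by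
  rcases hs.trichotomy ht with h | rfl | h
  · exact Or.inl (ht.sub_of_mem h)
  · exact Or.inl (Sub.refl s)
  · exact Or.inr (hs.sub_of_mem h)

theorem Bounding.and {P Q : M → M → Prop} (hP : Bounding P) (hQ : Bounding Q) :
    Bounding (fun r t => P r t ∧ Q r t) := by
  intro r hr
  obtain ⟨t₁, ht₁, h₁⟩ := hP r hr
  obtain ⟨t₂, ht₂, h₂⟩ := hQ r hr
  rcases ht₁.sub_total ht₂ with h | h
  · exact ⟨t₂, ht₂, fun t' ht' h' => ⟨h₁ t' ht' (h.trans h'), h₂ t' ht' h'⟩⟩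
  · exact ⟨t₁, ht₁, fun t' ht' h' => ⟨h₁ t' ht' h', h₂ t' ht' (h.trans h')⟩⟩

/-- Finitely many elements of a level are all subsets of one level in it. -/
theorem IsLevel.exists_bound_tuple {s : M} (hs : IsLevel s) (hne : ∃ r, IsLevel r ∧ r ε s) {n : ℕ}
    (v : Fin n → M) (hv : ∀ i, v i ε s) : ∃ r, IsLevel r ∧ r ε s ∧ ∀ i, Sub (v i) r := by
  induction n with
  | zero =>
    obtain ⟨r, hr⟩ := hne
    exact ⟨r, hr.1, hr.2, finZeroElim⟩
  | succ n ih =>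
    obtain ⟨r, hr, hrs, h⟩ := ih (fun i => v i.castSucc) (fun i => hv _)
    obtain ⟨r', hr', hrs', h'⟩ := hs.mem_iff.1 (hv (Fin.last n))
    rcases hr.sub_total hr' with h1 | h1
    · exact ⟨r', hr', hrs', Fin.lastCases h' fun i => (h i).trans h1⟩
    · exact ⟨r, hr, hrs, Fin.lastCases (h'.trans h1) h⟩

/-- Collection for tuples of elements of a set. -/
theorem exists_level_collection_tuple (a : M) {n : ℕ} {Q : (Fin n → M) → M → Prop}
    (hQ : FO (fun w : Fin n ⊕ Unit → M => Q (fun i => w (Sum.inl i)) (w (Sum.inr ()))))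
    (hmono : ∀ v t t', IsLevel t → IsLevel t' → Sub t t' → Q v t → Q v t')
    (h : ∀ v, (∀ i, v i ε a) → ∃ t, IsLevel t ∧ Q v t) :
    ∃ t, IsLevel t ∧ ∀ v, (∀ i, v i ε a) → Q v t := by
  induction n with
  | zero =>
    obtain ⟨t, ht, h⟩ := h finZeroElim finZeroElim
    exact ⟨t, ht, fun v _ => by rwa [Subsingleton.elim v finZeroElim]⟩
  | succ n ih =>
    let R : M → M → Prop := fun x t =>
      ∀ v : Fin n → M, (∀ i, v i ε a) → Q (Fin.snoc v x) t
    have hsnoc : ∀ {β : Type} (v : Fin n → (β → M) → M) (x t : (β → M) → M),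
        (∀ i, DF (v i)) → DF x → DF t →
          FO (fun w : β → M => Q (Fin.snoc (fun i => v i w) (x w)) (t w)) := by
      intro β v x t hv hx ht
      have := hQ.subst (Sum.elim (Fin.snoc (α := fun _ => (β → M) → M) v x) (fun _ => t)) (by
        rintro (i | i)
        · refine Fin.lastCases ?_ (fun i => ?_) i
          · simpa using hx
          · simpa using hv i
        · exact ht)
      refine FO.of_iff (hQ := this) fun w => Iff.of_eq (congrArg₂ _ ?_ rfl)
      ext i
      refine Fin.lastCases ?_ (fun i => ?_) i <;> simp
    have hR : FO₂ R := by
      refine FO.forall_tuple ?_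
      have h1 : FO (fun w : Fin 2 ⊕ Fin n → M => ∀ i, w (Sum.inr i) ε a) :=
        FO.forall_finite fun i => inferInstance
      have h2 : FO (fun w : Fin 2 ⊕ Fin n → M =>
          Q (Fin.snoc (fun i => w (Sum.inr i)) (w (Sum.inl 0))) (w (Sum.inl 1))) :=
        hsnoc _ _ _ (fun i => inferInstance) inferInstance inferInstance
      exact FO.imp
    obtain ⟨t, ht, h'⟩ := exists_level_collection hR a (fun x hx => by
      refine ih (Q := fun v t => Q (Fin.snoc v x) t)
        (hsnoc (fun i w => w (Sum.inl i)) (fun _ => x) (fun w => w (Sum.inr ()))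
          (fun i => inferInstance) inferInstance inferInstance)
        (fun v t t' => hmono _ t t') (fun v hv => h _ ?_)
      refine Fin.lastCases ?_ (fun i => ?_)
      · simpa using hx
      · simpa using hv i)
    refine ⟨t, ht, fun v hv => ?_⟩
    obtain ⟨s, hs, hR, hst⟩ := h' (v (Fin.last n)) (hv _)
    have := hR (fun i => v i.castSucc) (fun i => hv _)
    rw [show (Fin.snoc (fun i : Fin n => v i.castSucc) (v (Fin.last n)) : Fin (n + 1) → M) = v
      from Fin.snoc_init_self v] at this
    exact hmono v s t hs ht (ht.sub_of_mem hst) this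

/-- The reflection principle, for one formula: levels closed under a suitable definable function
satisfy the formula if and only if the well-founded part does. -/
theorem exists_reflecting {n : ℕ} (φ : memLang.BoundedFormula Empty n) :
    ∃ P : M → M → Prop, FO₂ P ∧ Bounding P ∧ ∀ s, IsLevel s → ClosedLevel P s →
      ∀ v : Fin n → M, (∀ i, v i ε s) →
        (relSat (fun x => x ε s) φ Empty.elim v ↔ relSat WF φ Empty.elim v) := by
  have htriv : FO₂ (fun _ _ : M => True) ∧ Bounding (fun _ _ : M => True) :=
    ⟨FO.true, fun r hr => ⟨r, hr, fun _ _ _ => trivial⟩⟩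
  induction φ with
  | falsum => exact ⟨fun _ _ => True, htriv.1, htriv.2, fun _ _ _ _ _ => Iff.rfl⟩
  | equal t₁ t₂ => exact ⟨fun _ _ => True, htriv.1, htriv.2, fun _ _ _ _ _ => Iff.rfl⟩
  | rel R ts => exact ⟨fun _ _ => True, htriv.1, htriv.2, fun _ _ _ _ _ => Iff.rfl⟩
  | imp φ ψ ih₁ ih₂ =>
    obtain ⟨P, hP, hPb, hPr⟩ := ih₁
    obtain ⟨Q, hQ, hQb, hQr⟩ := ih₂
    refine ⟨fun r t => P r t ∧ Q r t, FO.and, hPb.and hQb, fun s hs hcl v hv => ?_⟩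
    simp only [relSat]
    rw [hPr s hs (hcl.mono fun _ _ h => h.1) v hv, hQr s hs (hcl.mono fun _ _ h => h.2) v hv]
  | @all n φ ih =>
    obtain ⟨P, hP, hPb, hPr⟩ := ih
    -- `C v t`: if `∀ x, φ(v, x)` fails in the well-founded part, then `t` contains a counterexample.
    let C : (Fin n → M) → M → Prop := fun v t =>
      (∃ x, WF x ∧ ¬ relSat WF φ Empty.elim (Fin.snoc v x)) →
        ∃ x, x ε t ∧ ¬ relSat WF φ Empty.elim (Fin.snoc v x)
    have hsat : ∀ {β : Type} (v : Fin n → (β → M) → M) (x : (β → M) → M),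
        (∀ i, DF (v i)) → DF x →
          FO (fun w : β → M => relSat WF φ Empty.elim (Fin.snoc (fun i => v i w) (x w))) := by
      intro β v x hv hx
      have := (FO.relSat (M := M) (D := WF) inferInstance φ).subst
        (Sum.elim Empty.elim (Fin.snoc (α := fun _ => (β → M) → M) v x)) (by
          rintro (i | i)
          · exact i.elim
          · refine Fin.lastCases ?_ (fun i => ?_) i
            · simpa using hx
            · simpa using hv i)
      refine FO.of_iff (hQ := this) fun w => Iff.of_eq (congrArg₂ _ (Subsingleton.elim _ _) ?_)
      ext i
      refine Fin.lastCases ?_ (fun i => ?_) i <;> simp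
    have hC : ∀ {β : Type} (v : Fin n → (β → M) → M) (t : (β → M) → M),
        (∀ i, DF (v i)) → DF (fun w : β ⊕ Unit → M => t fun i => w (Sum.inl i)) →
        (∀ i, DF (fun w : β ⊕ Unit → M => v i fun i => w (Sum.inl i))) →
          FO (fun w : β → M => C (fun i => v i w) (t w)) := by
      intro β v t hv ht hv'
      have : FO (fun w : β ⊕ Unit → M => relSat WF φ Empty.elim
          (Fin.snoc (fun i => v i fun i => w (Sum.inl i)) (w (Sum.inr ())))) :=
        hsat (fun i w => v i fun i => w (Sum.inl i)) _ hv' inferInstance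
      unfold C
      infer_instance
    refine ⟨fun r t => P r t ∧ ∀ v : Fin n → M, (∀ i, v i ε r) → C v t, ?_, ?_, ?_⟩
    · have : FO₂ (fun r t : M => ∀ v : Fin n → M, (∀ i, v i ε r) → C v t) := by
        refine FO.forall_tuple ?_
        have h1 : FO (fun w : Fin 2 ⊕ Fin n → M => ∀ i, w (Sum.inr i) ε w (Sum.inl 0)) :=
          FO.forall_finite fun i => inferInstance
        have h2 : FO (fun w : Fin 2 ⊕ Fin n → M =>
            C (fun i => w (Sum.inr i)) (w (Sum.inl 1))) :=
          hC (fun i w => w (Sum.inr i)) (fun w => w (Sum.inl 1)) (fun i => inferInstance)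
            (inferInstanceAs (DF fun w : (Fin 2 ⊕ Fin n) ⊕ Unit → M => w (Sum.inl (Sum.inl 1))))
            (fun i => inferInstanceAs
              (DF fun w : (Fin 2 ⊕ Fin n) ⊕ Unit → M => w (Sum.inl (Sum.inr i))))
        exact FO.imp
      exact FO.and
    · refine hPb.and fun r hr => ?_
      obtain ⟨t, ht, h⟩ := exists_level_collection_tuple r (Q := C)
        (hC (fun i w => w (Sum.inl i)) (fun w => w (Sum.inr ())) (fun i => inferInstance)
          (inferInstanceAs (DF fun w : (Fin n ⊕ Unit) ⊕ Unit → M => w (Sum.inl (Sum.inr ()))))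
          (fun i => inferInstanceAs
            (DF fun w : (Fin n ⊕ Unit) ⊕ Unit → M => w (Sum.inl (Sum.inl i)))))
        (fun v t t' _ _ htt' h hx => by
          obtain ⟨x, hx, hx'⟩ := h hx
          exact ⟨x, htt' x hx, hx'⟩)
        (fun v hv => by
          by_cases hx : ∃ x, WF x ∧ ¬ relSat WF φ Empty.elim (Fin.snoc v x)
          · obtain ⟨x, ⟨t, ht, hxt⟩, hx'⟩ := hx
            exact ⟨t, ht, fun _ => ⟨x, hxt, hx'⟩⟩
          · exact ⟨r, hr, fun h => absurd h hx⟩)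
      refine ⟨t, ht, fun t' ht' htt' v hv hx => ?_⟩
      obtain ⟨x, hx, hx'⟩ := h v hv hx
      exact ⟨x, htt' x hx, hx'⟩
    · intro s hs hcl v hv
      have hφ : ∀ x, x ε s → (relSat (fun x => x ε s) φ Empty.elim (Fin.snoc v x) ↔
          relSat WF φ Empty.elim (Fin.snoc v x)) := fun x hx =>
        hPr s hs (hcl.mono fun _ _ h => h.1) _ (Fin.lastCases (by simpa using hx)
          (fun i => by simpa using hv i))
      simp only [relSat]
      constructor
      · intro h
        by_contra! hx
        obtain ⟨r, hr, hrs, hvr⟩ := hs.exists_bound_tuple hcl.1 v hv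
        obtain ⟨r', t, hr', -, hrr', ht, hts, -, hC⟩ := hcl.2 r hr hrs
        obtain ⟨x, hxt, hx⟩ := hC v (fun i => hr'.potent _ r (hvr i) hrr') hx
        have hxs := hs.sub_of_mem hts x hxt
        exact hx ((hφ x hxs).1 (h x hxs))
      · intro h x hx
        exact (hφ x hx).2 (h x ⟨s, hs, hx⟩)

/-- Closure points exist. One is found by iterating, along the natural numbers of the model, the
function that takes a level `r` to the least level `t` above it with `P r t`: `Φ n y` below says
that some set of pairs witnesses that `y` is the `n`-th iterate. -/
theorem Bounding.exists_closedLevel {P : M → M → Prop} (hP : FO₂ P) (hPb : Bounding P) :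
    ∃ s, IsLevel s ∧ ClosedLevel P s := by
  have : ∀ {α : Type} {f g : (α → M) → M} [DF f] [DF g], FO (fun v => P (f v) (g v)) :=
    fun {α f g} _ _ => FO.app₂ hP
  -- `Next r t`: `t` is the least level above `r` with `P r t`.
  let Next : M → M → Prop := fun r t => (IsLevel t ∧ r ε t ∧ P r t) ∧
    ∀ t', (IsLevel t' ∧ r ε t' ∧ P r t') → t ε t' ∨ t = t'
  have hN : FO₂ Next := by unfold Next; infer_instance
  have : ∀ {α : Type} {f g : (α → M) → M} [DF f] [DF g], FO (fun v => Next (f v) (g v)) :=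
    fun {α f g} _ _ => FO.app₂ hN
  have next_exists : ∀ r, IsLevel r → ∃ t, Next r t := by
    intro r hr
    obtain ⟨t, ht, h⟩ := hPb r hr
    refine exists_least_level (P := fun t : M => IsLevel t ∧ r ε t ∧ P r t) inferInstance
      (fun s hs => hs.1) ?_
    obtain ⟨t', ht', hrt'⟩ := hr.exists_mem
    rcases ht.sub_total ht' with h1 | h1
    · exact ⟨t', ht', hrt', h t' ht' h1⟩
    · exact ⟨t, ht, h1 r hrt', h t ht (Sub.refl t)⟩
  have next_unique : ∀ r t t', Next r t → Next r t' → t = t' := by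
    rintro r t t' ⟨h1, h2⟩ ⟨h1', h2'⟩
    rcases h2 t' h1' with h | h
    · rcases h2' t h1 with h' | h'
      · exact absurd (h1.1.sub_of_mem h' t h) h1.1.not_mem_self
      · exact h'.symm
    · exact h
  obtain ⟨s₀, hs₀, -⟩ := wf_emp (M := M)
  let Attempt : M → Prop := fun g => ∀ p, p ε g → p = opair (emp M) s₀ ∨
    ∃ m x y, opair m x ε g ∧ Next x y ∧ p = opair (succ m) y
  let Φ : M → M → Prop := fun n y => ∃ g, Attempt g ∧ opair n y ε g
  have hΦ : FO₂ Φ := by unfold Φ Attempt; infer_instance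
  have : ∀ {α : Type} {f g : (α → M) → M} [DF f] [DF g], FO (fun v => Φ (f v) (g v)) :=
    fun {α f g} _ _ => FO.app₂ hΦ
  have Φ_zero : Φ (emp M) s₀ := by
    obtain ⟨g, hg⟩ := IsSet.singleton (opair (emp M) s₀)
    exact ⟨g, fun p hp => Or.inl ((hg p).1 hp), (hg _).2 rfl⟩
  have Φ_succ : ∀ n y z, Φ n y → Next y z → Φ (succ n) z := by
    rintro n y z ⟨g, hg, hny⟩ hyz
    obtain ⟨g', hg'⟩ := (IsSet.mem g).or (IsSet.singleton (opair (succ n) z))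
    refine ⟨g', fun p hp => ?_, (hg' _).2 (Or.inr rfl)⟩
    rcases (hg' p).1 hp with hp | rfl
    · rcases hg p hp with h | ⟨m, x, y, h1, h2, h3⟩
      · exact Or.inl h
      · exact Or.inr ⟨m, x, y, (hg' _).2 (Or.inl h1), h2, h3⟩
    · exact Or.inr ⟨n, y, z, (hg' _).2 (Or.inl hny), hyz, rfl⟩
  have Φ_nat : ∀ n, IsNat n → ∃ y, (IsLevel y ∧ Φ n y) ∧ ∀ y', Φ n y' → y' = y := by
    intro n hn
    refine IsNat.induction (P := fun n : M => ∃ y, (IsLevel y ∧ Φ n y) ∧ ∀ y', Φ n y' → y' = y)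
      inferInstance ⟨s₀, ⟨hs₀, Φ_zero⟩, ?_⟩ ?_ hn
    · rintro y ⟨g, hg, hy⟩
      rcases hg _ hy with h | ⟨m, x, z, -, -, h⟩
      · exact (opair_inj.1 h).2
      · exact absurd (opair_inj.1 h).1.symm (succ_ne_emp m)
    · rintro n hn ⟨y, ⟨hy, hny⟩, hyu⟩
      obtain ⟨z, hz⟩ := next_exists y hy
      refine ⟨z, ⟨hz.1.1, Φ_succ n y z hny hz⟩, ?_⟩
      rintro z' ⟨g, hg, hz'⟩
      rcases hg _ hz' with h | ⟨m, x, z'', h1, h2, h3⟩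
      · exact absurd (opair_inj.1 h).1 (succ_ne_emp n)
      · obtain ⟨h4, rfl⟩ := opair_inj.1 h3
        obtain rfl := hn.succ_inj h4
        obtain rfl := hyu x ⟨g, hg, h1⟩
        exact next_unique _ _ _ h2 hz
  have hset : IsSet (fun y : M => ∃ n, n ε mkSet IsNat ∧ Φ n y) :=
    IsSet.replace hΦ _ (by
      intro n y z hn hy hz
      obtain ⟨y', -, h⟩ := Φ_nat n ((mem_mkSet isSet_isNat).1 hn)
      rw [h y hy, h z hz])
  have mem_nat : ∀ n : M, n ε mkSet IsNat ↔ IsNat n := fun n => mem_mkSet isSet_isNat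
  simp only [mem_nat] at hset
  have hlev : ∀ y, (∃ n, IsNat n ∧ Φ n y) → IsLevel y := by
    rintro y ⟨n, hn, hy⟩
    obtain ⟨y', h, h'⟩ := Φ_nat n hn
    rw [h' y hy]
    exact h.1
  -- The closure point is the supremum of the iterates.
  obtain ⟨s, ⟨hs, hbd⟩, hleast⟩ := exists_least_level
    (P := fun t : M => IsLevel t ∧ ∀ y, (∃ n : M, IsNat n ∧ Φ n y) → y ε t)
    inferInstance (fun s hs => hs.1) (exists_level_of_isSet inferInstance hset hlev)
  refine ⟨s, hs, ⟨s₀, hs₀, hbd s₀ ⟨emp M, isNat_emp, Φ_zero⟩⟩, fun r hr hrs => ?_⟩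
  have : ∃ y, (∃ n, IsNat n ∧ Φ n y) ∧ ¬ y ε r := by
    by_contra! hcon
    rcases hleast r ⟨hr, hcon⟩ with h | rfl
    · exact hs.not_mem_self (hs.sub_of_mem hrs s h)
    · exact hs.not_mem_self hrs
  obtain ⟨y, ⟨n, hn, hny⟩, hyr⟩ := this
  have hy := hlev y ⟨n, hn, hny⟩
  obtain ⟨z, hz⟩ := next_exists y hy
  obtain ⟨t, ht⟩ := next_exists z hz.1.1
  have hnz := Φ_succ n y z hny hz
  refine ⟨z, t, hz.1.1, hbd z ⟨_, hn.succ, hnz⟩, ?_, ht.1.1,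
    hbd t ⟨_, hn.succ.succ, Φ_succ _ z t hnz ht⟩, ht.1.2.2⟩
  rcases hy.trichotomy hr with h | rfl | h
  · exact absurd h hyr
  · exact hz.1.2.1
  · exact hz.1.1.sub_of_mem hz.1.2.1 r h

/-- Every finite set of axioms of `ZFC` holds in some non-empty set of the model. -/
theorem exists_set_model (Δ : memLang.Theory) (hΔ : Δ ⊆ ZFC) (hfin : Δ.Finite) :
    ∃ s : M, (∃ x, x ε s) ∧ {x // x ε s} ⊨ Δ := by
  have key : ∀ Δ : memLang.Theory, Δ.Finite → ∃ P : M → M → Prop, FO₂ P ∧ Bounding P ∧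
      ∀ s : M, IsLevel s → ClosedLevel P s → ∀ σ ∈ Δ,
        (relSat (fun x : M => x ε s) σ Empty.elim finZeroElim ↔
          relSat (WF (M := M)) σ Empty.elim finZeroElim) := by
    intro Δ hfin
    induction Δ, hfin using Set.Finite.induction_on with
    | empty =>
      exact ⟨fun _ _ => True, FO.true, fun r hr => ⟨r, hr, fun _ _ _ => trivial⟩,
        fun _ _ _ σ hσ => hσ.elim⟩
    | @insert σ Δ _ _ ih =>
      obtain ⟨P, hP, hPb, hPr⟩ := ih
      obtain ⟨Q, hQ, hQb, hQr⟩ := exists_reflecting (M := M) σ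
      refine ⟨fun r t => P r t ∧ Q r t, FO.and, hPb.and hQb, fun s hs hcl => ?_⟩
      rintro τ (rfl | hτ)
      · exact hQr s hs (hcl.mono fun _ _ h => h.2) finZeroElim finZeroElim
      · exact hPr s hs (hcl.mono fun _ _ h => h.1) τ hτ
  obtain ⟨P, hP, hPb, hPr⟩ := key Δ hfin
  obtain ⟨s, hs, hcl⟩ := hPb.exists_closedLevel hP
  obtain ⟨r, -, hr⟩ := hcl.1
  refine ⟨s, ⟨r, hr⟩, (Theory.model_iff _).2 fun σ hσ => ?_⟩
  have h1 : {x : M // WF x} ⊨ σ := (Theory.model_iff _).1 WF.models_ZFC σ (hΔ hσ)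
  unfold Sentence.Realize Formula.Realize at h1 ⊢
  rw [realize_class_iff] at h1 ⊢
  have h2 := hPr s hs hcl σ hσ
  have h3 : ∀ (D : M → Prop) (v v' : Empty → M) (xs xs' : Fin 0 → M),
      relSat D σ v xs → relSat D σ v' xs' := fun D v v' xs xs' h => by
    rwa [Subsingleton.elim v' v, Subsingleton.elim xs' xs]
  exact h3 _ _ _ _ _ (h2.2 (h3 _ _ _ _ _ h1))

end Reflection

/-! ### Graphs on several copies of a set -/

section Families

variable {M : Type u} [memLang.Structure M] [hM : M ⊨ ZFCWithoutFoundation]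

variable (M) in
/-- The `n`-fold singleton `{…{∅}…}`. -/
noncomputable def tag : ℕ → M
  | 0 => emp M
  | n + 1 => upair (tag n) (tag n)

theorem tag_injective : Function.Injective (tag M) := by
  intro m
  induction m with
  | zero =>
    rintro (_ | n) h
    · rfl
    · have : tag M n ε tag M (n + 1) := mem_upair.2 (Or.inl rfl)
      rw [← h] at this
      simp [tag] at this
  | succ m ih =>
    rintro (_ | n) h
    · have : tag M m ε tag M (m + 1) := mem_upair.2 (Or.inl rfl)
      rw [h] at this
      simp [tag] at this
    · have : tag M m ε tag M (n + 1) := h ▸ mem_upair.2 (Or.inl rfl)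
      rw [ih (or_self_iff.1 (mem_upair.1 this))]

theorem emp_not_mem_opair (x y : M) : ¬ emp M ε opair x y := by
  intro h
  rcases mem_upair.1 h with h | h
  · have : x ε upair x x := mem_upair.2 (Or.inl rfl)
    simp [← h] at this
  · have : x ε upair x y := mem_upair.2 (Or.inl rfl)
    simp [← h] at this

omit hM in
theorem FO.exists_finite {α ι : Type} [Finite ι] {P : ι → (α → M) → Prop} (hP : ∀ i, FO (P i)) :
    FO (fun v => ∃ i, P i v) := by
  have : FO (fun v => ∀ i, ¬ P i v) := FO.forall_finite fun i => FO.not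
  exact FO.of_iff (Q := fun v => ¬ ∀ i, ¬ P i v) fun _ => by simp

theorem IsSet.exists_finset {ι : Type} (F : Finset ι) {P : ι → M → Prop} (hP : ∀ i, IsSet (P i)) :
    IsSet (fun x => ∃ i ∈ F, P i x) := by
  classical
  induction F using Finset.induction_on with
  | empty => simpa using IsSet.false
  | insert i F _ ih => simpa using (hP i).or ih

/-- A symmetric graph on finitely many disjoint copies `(i, x)`, `x ∈ s`, of a set `s` of `M`,
definable between any two copies, is isomorphic to a union of connected components of the
double-membership graph. -/
theorem exists_realization_of_family (hA : M ⊨ antiFoundation) {I : Type} [Finite I] (s : M)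
    {R : I → I → M → M → Prop} (hR : ∀ i j, FO₂ (R i j))
    (symm : ∀ i j x y, R i j x y → R j i y x) :
    ∃ u : I → M → M, (∀ i j x y, x ε s → y ε s → u i x = u j y → i = j ∧ x = y) ∧
      ∀ i x, x ε s → ∀ y, (u i x ε y ∧ y ε u i x) ↔ ∃ j z, z ε s ∧ R i j x z ∧ y = u j z := by
  have := Fintype.ofFinite I
  obtain ⟨t, ht⟩ : ∃ t : I → M, Function.Injective t :=
    ⟨fun i => tag M (Finite.equivFin I i), fun i j h => by
      simpa [Fin.val_inj] using tag_injective h⟩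
  have hR' : ∀ (i j) {α : Type} {f g : (α → M) → M} [DF f] [DF g],
      FO (fun v => R i j (f v) (g v)) := fun i j {α f g} _ _ => FO.app₂ (hR i j)
  let R' : M → M → Prop := fun v w => ∃ i j, ∃ x y, v = opair x (t i) ∧ w = opair y (t j) ∧ R i j x y
  have hR'' : FO₂ R' := FO.exists_finite fun i => FO.exists_finite fun j => inferInstance
  have R'_iff : ∀ i j x y, R' (opair x (t i)) (opair y (t j)) ↔ R i j x y := by
    intro i j x y
    constructor
    · rintro ⟨i', j', x', y', h1, h2, h⟩
      obtain ⟨rfl, e1⟩ := opair_inj.1 h1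
      obtain ⟨rfl, e2⟩ := opair_inj.1 h2
      rwa [ht e1, ht e2]
    · intro h
      exact ⟨i, j, x, y, rfl, rfl, h⟩
  obtain ⟨V, hV⟩ := IsSet.exists_finset Finset.univ
    (P := fun (i : I) (v : M) => ∃ x, x ε s ∧ v = opair x (t i))
    (fun i => IsSet.image inferInstance s)
  replace hV : ∀ v, v ε V ↔ ∃ i, ∃ x, x ε s ∧ v = opair x (t i) := fun v => by simp [hV]
  obtain ⟨f, hinj, hf⟩ := exists_realization_of_graph hA V (by
    intro v hv
    obtain ⟨i, x, -, rfl⟩ := (hV v).1 hv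
    exact emp_not_mem_opair _ _) hR'' (by
    rintro _ _ ⟨i, j, x, y, rfl, rfl, h⟩
    exact ⟨j, i, y, x, rfl, rfl, symm _ _ _ _ h⟩)
  refine ⟨fun i x => f (opair x (t i)), fun i j x y hx hy h => ?_, fun i x hx y => ?_⟩
  · obtain ⟨h1, h2⟩ := opair_inj.1
      (hinj _ _ ((hV _).2 ⟨i, x, hx, rfl⟩) ((hV _).2 ⟨j, y, hy, rfl⟩) h)
    exact ⟨ht h2, h1⟩
  · rw [hf _ ((hV _).2 ⟨i, x, hx, rfl⟩)]
    constructor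
    · rintro ⟨w, hw, h, rfl⟩
      obtain ⟨j, z, hz, rfl⟩ := (hV w).1 hw
      exact ⟨j, z, hz, (R'_iff _ _ _ _).1 h, rfl⟩
    · rintro ⟨j, z, hz, h, rfl⟩
      exact ⟨_, (hV _).2 ⟨j, z, hz, rfl⟩, (R'_iff _ _ _ _).2 h, rfl⟩

end Families

/-! ### Structures coded by a vertex -/

section Interpretation

/-- Adjacency in a structure for the language of graphs. -/
def Adj {N : Type w} [FirstOrder.Language.graph.Structure N] (x y : N) : Prop :=
  Structure.RelMap (adj : FirstOrder.Language.graph.Relations 2) ![x, y]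

/-- The relation on the neighbours of `p` that is read as membership. A vertex `y` standing for an
element has a neighbour `m` with a loop, whose further neighbour `c` not adjacent to `p` stands for
the same set; the neighbours of `c` among those of `p` are the elements of that set. -/
def CodeMem {N : Type w} [FirstOrder.Language.graph.Structure N] (p x y : N) : Prop :=
  ∃ m c, Adj y m ∧ Adj m m ∧ Adj m c ∧ c ≠ m ∧ ¬ Adj p c ∧ Adj c x

/-- The structure for the language of set theory that the vertex `p` codes: its domain consists of
the neighbours of `p`. -/
def Coded {N : Type w} [FirstOrder.Language.graph.Structure N] (p : N) : Type w := {x : N // Adj p x}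

instance {N : Type w} [FirstOrder.Language.graph.Structure N] (p : N) :
    memLang.Structure (Coded p) where
  funMap f := Empty.elim f
  RelMap | .mem => fun v => CodeMem p (v 0).1 (v 1).1

variable {n : ℕ}

/-- The variables `s` and `t` are adjacent. -/
def adjF {α : Type} (s t : α ⊕ Fin n) : FirstOrder.Language.graph.BoundedFormula α n :=
  (adj : FirstOrder.Language.graph.Relations 2).boundedFormula₂ (Term.var s) (Term.var t)

/-- `vᵢ` is adjacent to the parameter. -/
def nbrF (i : Fin n) : FirstOrder.Language.graph.BoundedFormula (Fin 1) n :=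
  adjF (Sum.inl 0) (Sum.inr i)

/-- The formula defining `CodeMem`. -/
def codeMemF (i j : Fin n) : FirstOrder.Language.graph.BoundedFormula (Fin 1) n :=
  ∃' ∃' (adjF (Sum.inr (Fin.castAdd 2 j)) (Sum.inr (bv n 2 0)) ⊓
    (adjF (Sum.inr (bv n 2 0)) (Sum.inr (bv n 2 0)) ⊓
    (adjF (Sum.inr (bv n 2 0)) (Sum.inr (bv n 2 1)) ⊓
    (∼(Term.bdEqual (Term.var (Sum.inr (bv n 2 1))) (Term.var (Sum.inr (bv n 2 0)))) ⊓
    (∼(nbrF (bv n 2 1)) ⊓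
    adjF (Sum.inr (bv n 2 1)) (Sum.inr (Fin.castAdd 2 i)))))))

/-- The variable that a term of the language of set theory is. -/
def varIdx : memLang.Term (Empty ⊕ Fin n) → Fin n
  | .var (Sum.inr i) => i
  | .func f _ => Empty.elim f

/-- The translation of a formula about the coded structure into a formula about the graph. -/
def translate : ∀ {n : ℕ}, memLang.BoundedFormula Empty n →
    FirstOrder.Language.graph.BoundedFormula (Fin 1) n
  | _, .falsum => ⊥
  | _, .equal t₁ t₂ => Term.bdEqual (Term.var (Sum.inr (varIdx t₁))) (Term.var (Sum.inr (varIdx t₂)))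
  | _, .rel MemRel.mem ts => codeMemF (varIdx (ts 0)) (varIdx (ts 1))
  | _, .imp φ ψ => (translate φ).imp (translate ψ)
  | n, .all φ => ∀' ((nbrF (Fin.last n)).imp (translate φ))

variable {N : Type w} [FirstOrder.Language.graph.Structure N] {p : N}

@[simp]
theorem realize_adjF {α : Type} {s t : α ⊕ Fin n} {v : α → N} {xs : Fin n → N} :
    (adjF s t).Realize v xs ↔ Adj (Sum.elim v xs s) (Sum.elim v xs t) := by
  simp [adjF, Adj]

@[simp]
theorem realize_nbrF {i : Fin n} {xs : Fin n → N} :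
    (nbrF i).Realize (fun _ => p) xs ↔ Adj p (xs i) := by
  simp [nbrF]

@[simp]
theorem realize_codeMemF {i j : Fin n} {xs : Fin n → N} :
    (codeMemF i j).Realize (fun _ => p) xs ↔ CodeMem p (xs i) (xs j) := by
  simp [codeMemF, CodeMem]
  simp [Fin.snoc]

theorem realize_varIdx (t : memLang.Term (Empty ⊕ Fin n)) (xs : Fin n → Coded p)
    (v : Empty → Coded p) : t.realize (Sum.elim v xs) = xs (varIdx t) := by
  match t with
  | .var (Sum.inr i) => rfl
  | .func f _ => exact Empty.elim f

theorem realize_translate (φ : memLang.BoundedFormula Empty n) (v : Empty → Coded p)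
    (xs : Fin n → Coded p) :
    (translate φ).Realize (fun _ => p) (fun i => (xs i).1) ↔ φ.Realize v xs := by
  induction φ with
  | falsum => exact Iff.rfl
  | equal t₁ t₂ =>
    simp only [translate, BoundedFormula.Realize, realize_varIdx, BoundedFormula.realize_bdEqual,
      Term.realize_var, Sum.elim_inr]
    exact Subtype.ext_iff.symm
  | rel R ts =>
    cases R
    simp only [translate, BoundedFormula.Realize, realize_varIdx, realize_codeMemF]
    exact Iff.rfl
  | imp φ ψ ih₁ ih₂ => simp only [translate, BoundedFormula.realize_imp, ih₁, ih₂]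
  | all φ ih =>
    simp only [translate, BoundedFormula.realize_all, BoundedFormula.realize_imp, realize_nbrF,
      Fin.snoc_last, ← ih]
    have : ∀ x : Coded p, (fun i => ((Fin.snoc xs x : Fin (_ + 1) → Coded p) i).1) =
        (Fin.snoc (fun i => (xs i).1) x.1 : Fin (_ + 1) → N) := fun x => by
      ext i
      refine Fin.lastCases ?_ (fun i => ?_) i <;> simp
    simp only [this]
    exact ⟨fun h x => h x.1 x.2, fun h x hx => h ⟨x, hx⟩⟩

/-- For a finite theory `Δ`, the formula saying that the parameter codes a non-empty model of
`Δ`. -/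
noncomputable def codesModelF (Δ : memLang.Theory) [Finite Δ] :
    FirstOrder.Language.graph.Formula (Fin 1) :=
  (∃' nbrF (Fin.last 0)) ⊓ BoundedFormula.iInf fun σ : Δ => translate σ.1

/-- The sentence saying that some vertex codes a non-empty model of `Δ`. -/
noncomputable def existsCodeF (Δ : memLang.Theory) [Finite Δ] :
    FirstOrder.Language.graph.Sentence :=
  Formula.iExs (Fin 1) ((codesModelF Δ).relabel Sum.inr)

theorem realize_codesModelF (Δ : memLang.Theory) [Finite Δ] :
    (codesModelF Δ).Realize (fun _ => p) ↔ Nonempty (Coded p) ∧ Coded p ⊨ Δ := by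
  unfold codesModelF Formula.Realize
  rw [BoundedFormula.realize_inf, BoundedFormula.realize_iInf]
  refine and_congr ?_ ?_
  · simp only [BoundedFormula.realize_ex, realize_nbrF, Fin.snoc_last]
    exact ⟨fun ⟨a, ha⟩ => ⟨⟨a, ha⟩⟩, fun ⟨a⟩ => ⟨a.1, a.2⟩⟩
  · rw [Theory.model_iff]
    simp only [Subtype.forall]
    refine forall_congr' fun σ => forall_congr' fun _ => ?_
    rw [Sentence.Realize, Formula.Realize, ← realize_translate]
    exact Iff.of_eq (congrArg _ (Subsingleton.elim _ _))

theorem realize_existsCodeF (Δ : memLang.Theory) [Finite Δ] :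
    N ⊨ existsCodeF Δ ↔ ∃ p : N, Nonempty (Coded p) ∧ Coded p ⊨ Δ := by
  rw [existsCodeF, Sentence.Realize, Formula.realize_iExs]
  simp only [Formula.realize_relabel, Sum.elim_comp_inr, ← realize_codesModelF]
  constructor
  · rintro ⟨i, hi⟩
    refine ⟨i 0, ?_⟩
    rwa [show (fun _ => i 0) = i from funext fun j => by rw [Subsingleton.elim j 0] ]
  · rintro ⟨p, hp⟩
    exact ⟨fun _ => p, hp⟩

/-- A formula with parameter `p` and variables substituted along `g` defines a set. -/
theorem definable_of_boundedFormula {ι : Type} [Finite ι]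
    (ψ : FirstOrder.Language.graph.BoundedFormula (Fin 1) n) (p : N) (g : Fin n → ι) :
    (Set.univ : Set N).Definable FirstOrder.Language.graph
      {t : ι → N | ψ.Realize (fun _ => p) (fun i => t (g i))} := by
  have h1 : (Set.univ : Set N).Definable FirstOrder.Language.graph
      {v : Fin 1 ⊕ Fin n → N | ψ.Realize (v ∘ Sum.inl) (v ∘ Sum.inr)} := by
    refine Set.Definable.mono (Set.empty_definable_iff.2 ⟨ψ.toFormula, ?_⟩) (Set.empty_subset _)
    ext v
    exact (BoundedFormula.realize_toFormula ψ v).symm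
  refine Set.Definable.preimage_map (F := fun t => Sum.elim (fun _ => p) (fun i => t (g i))) ?_ h1
  rintro (i | i)
  · exact definableFun_const _ _ (Set.mem_univ p)
  · exact Set.DefinableFun.proj _

/-- The interpretation is one-dimensional, with equality of vertices as equality. -/
theorem interprets_coded (p : N) [Nonempty (Coded p)] :
    Interprets FirstOrder.Language.graph N memLang (Coded p) := by
  classical
  obtain ⟨c⟩ := ‹Nonempty (Coded p)›
  -- The value `c` is taken outside the domain of the interpretation, where it plays no role.
  let f : (Fin 1 → N) → Coded p := fun x => if h : Adj p (x 0) then ⟨x 0, h⟩ else c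
  have hf : ∀ x : Fin 1 → N, Adj p (x 0) → (f x).1 = x 0 := fun x h => by simp [f, h]
  refine ⟨1, {x | Adj p (x 0)}, f, ?_, ?_, ?_, ?_, fun k F => Empty.elim F⟩
  · rintro ⟨x, hx⟩ -
    exact ⟨fun _ => x, hx, Subtype.ext (hf (fun _ => x) hx)⟩
  · convert! definable_of_boundedFormula (nbrF 0) p (id : Fin 1 → Fin 1) using 1
    ext x
    simp
  · convert! definable_of_boundedFormula (nbrF 0 ⊓ nbrF 1 ⊓
      Term.bdEqual (Term.var (Sum.inr 0)) (Term.var (Sum.inr 1))) p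
      (fun i : Fin 2 => (i, (0 : Fin 1))) using 1
    ext t
    simp only [Set.mem_ofPred_eq, Fin.forall_fin_two, BoundedFormula.realize_inf, realize_nbrF,
      BoundedFormula.realize_bdEqual, Term.realize_var, Sum.elim_inr]
    refine and_congr_right fun h => ?_
    refine Subtype.ext_iff.trans (iff_of_eq (congrArg₂ Eq (hf (fun j => t (0, j)) h.1)
      (hf (fun j => t (1, j)) h.2)))
  · rintro k ⟨⟩
    convert! definable_of_boundedFormula (nbrF 0 ⊓ nbrF 1 ⊓ codeMemF 0 1) p
      (fun i : Fin 2 => (i, (0 : Fin 1))) using 1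
    ext t
    simp only [Set.mem_ofPred_eq, Fin.forall_fin_two, BoundedFormula.realize_inf, realize_nbrF,
      realize_codeMemF]
    refine and_congr_right fun h => ?_
    refine Iff.trans ?_ (iff_of_eq (congrArg₂ (CodeMem p) (hf (fun j => t (0, j)) h.1)
      (hf (fun j => t (1, j)) h.2)))
    exact Iff.rfl

end Interpretation

/-! ### Coding a set by a vertex -/

section Coding

/-- The kinds of vertices in the graph that codes a set of the model. -/
inductive Kind
  /-- adjacent to the vertices that stand for the elements of the set -/
  | root
  /-- the vertex that stands for `x` as an element of other sets -/
  | elt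
  /-- connects the two vertices that stand for `x` -/
  | link
  /-- the vertex that stands for `x` as a set of other elements -/
  | copy

instance : Finite Kind :=
  Finite.of_injective (fun | .root => 0 | .elt => 1 | .link => 2 | .copy => 3 : Kind → Fin 4) (by
    rintro (_ | _ | _ | _) (_ | _ | _ | _) h <;> first | rfl | simp at h)

variable {M : Type u} [memLang.Structure M]

/-- Adjacency in the graph that codes a set of the model. Of the vertices of kind `root` only the
one for `x₀` matters; a loop marks those of kind `link`. -/
def codeRel (x₀ : M) : Kind → Kind → M → M → Prop
  | .root, .elt, x, _ => x = x₀
  | .elt, .root, _, y => y = x₀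
  | .elt, .link, x, y => x = y
  | .link, .elt, x, y => x = y
  | .link, .link, x, y => x = y
  | .link, .copy, x, y => x = y
  | .copy, .link, x, y => x = y
  | .elt, .copy, x, y => x ε y
  | .copy, .elt, x, y => y ε x
  | _, _, _, _ => False

theorem codeRel_definable (x₀ : M) (i j : Kind) : FO₂ (codeRel x₀ i j) := by
  unfold FO₂
  cases i <;> cases j <;> simp only [codeRel] <;> infer_instance

theorem codeRel_symm (x₀ : M) (i j : Kind) (x y : M) (h : codeRel x₀ i j x y) :
    codeRel x₀ j i y x := by
  cases i <;> cases j <;> simp only [codeRel] at h ⊢ <;> first | exact h | exact h.symm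

variable [hM : M ⊨ ZFCWithoutFoundation]

/-- Every non-empty set of the model, with its membership relation, is coded by a vertex of the
double-membership graph. -/
theorem exists_coded_equiv (hA : M ⊨ antiFoundation) (s : M) (hs : ∃ x, x ε s) :
    ∃ p : DGraph M, Nonempty ({x // x ε s} ≃[memLang] Coded p) := by
  obtain ⟨x₀, hx₀⟩ := hs
  obtain ⟨u, hinj, hu⟩ := exists_realization_of_family hA s (codeRel_definable x₀)
    (codeRel_symm x₀)
  let U : Kind → M → DGraph M := u
  have adj_U : ∀ i x, x ε s → ∀ y : DGraph M,
      Adj (U i x) y ↔ ∃ j z, z ε s ∧ codeRel x₀ i j x z ∧ y = U j z := hu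
  have adj_UU : ∀ i j x y, x ε s → y ε s → (Adj (U i x) (U j y) ↔ codeRel x₀ i j x y) := by
    intro i j x y hx hy
    rw [adj_U i x hx]
    constructor
    · rintro ⟨j', z, hz, h, h'⟩
      obtain ⟨rfl, rfl⟩ := hinj _ _ _ _ hy hz h'
      exact h
    · intro h
      exact ⟨j, y, hy, h, rfl⟩
  let p := U .root x₀
  have adj_p : ∀ i x, x ε s → (Adj p (U i x) ↔ i = .elt) := by
    intro i x hx
    rw [adj_UU _ _ _ _ hx₀ hx]
    cases i <;> simp [codeRel]
  have code : ∀ a b, a ε s → b ε s → (CodeMem p (U .elt a) (U .elt b) ↔ a ε b) := by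
    intro a b ha hb
    constructor
    -- The looped neighbour `m` has to be the `link` of `b`. Its neighbours are itself, the vertex
    -- `elt` of `b`, which is adjacent to `p`, and the `copy` of `b`, so the last one is `c`.
    · rintro ⟨m, c, h1, h2, h3, h4, h5, h6⟩
      obtain ⟨i, z, hz, hR, rfl⟩ := (adj_U _ _ hb _).1 h1
      rw [adj_UU _ _ _ _ hz hz] at h2
      cases i <;> simp only [codeRel] at h2 hR
      subst hR
      obtain ⟨j, z, hz, hR, rfl⟩ := (adj_U _ _ hb _).1 h3
      rw [adj_p _ _ hz] at h5
      cases j <;> simp only [codeRel] at hR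
      · exact absurd rfl h5
      · exact absurd (hR ▸ rfl) h4
      · subst hR
        exact (adj_UU _ _ _ _ hb ha).1 h6
    · intro hab
      refine ⟨U .link b, U .copy b, (adj_UU _ _ _ _ hb hb).2 rfl, (adj_UU _ _ _ _ hb hb).2 rfl,
        (adj_UU _ _ _ _ hb hb).2 rfl, fun h => ?_, ?_, (adj_UU _ _ _ _ hb ha).2 hab⟩
      · exact absurd (hinj _ _ _ _ hb hb h).1 (by simp)
      · rw [adj_p _ _ hb]
        simp
  let F : {x // x ε s} → Coded p := fun x => ⟨U .elt x, (adj_p _ _ x.2).2 rfl⟩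
  have hF : Function.Bijective F := by
    constructor
    · intro x y h
      exact Subtype.ext (hinj _ _ _ _ x.2 y.2 (congrArg Subtype.val h)).2
    · rintro ⟨y, hy⟩
      obtain ⟨i, z, hz, -, rfl⟩ := (adj_U _ _ hx₀ _).1 hy
      obtain rfl := (adj_p _ _ hz).1 hy
      exact ⟨⟨z, hz⟩, rfl⟩
  refine ⟨p, ⟨{ Equiv.ofBijective F hF with
    map_fun' := fun f => Empty.elim f
    map_rel' := ?_ }⟩⟩
  rintro k ⟨⟩ x
  have h := (code _ _ (x 0).2 (x 1).2).trans (coe_mem (D := fun x => x ε s)).symm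
  refine h.trans (iff_of_eq (congrArg (Structure.RelMap memSym) ?_))
  ext i
  fin_cases i <;> rfl

/-- Every structure elementarily equivalent to the double-membership graph interprets models of all
finite fragments of `ZFC`. -/
theorem interpretsTheory_of_model_completeTheory (hA : M ⊨ antiFoundation) (N : Type v)
    [FirstOrder.Language.graph.Structure N]
    (hN : N ⊨ FirstOrder.Language.graph.completeTheory (DGraph M)) (Δ : memLang.Theory)
    (hΔ : Δ ⊆ ZFC) (hfin : Δ.Finite) : InterpretsTheory FirstOrder.Language.graph N Δ := by
  have := hfin.to_subtype
  obtain ⟨s, ⟨x, hx⟩, hs⟩ := exists_set_model (M := M) Δ hΔ hfin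
  obtain ⟨p, ⟨e⟩⟩ := exists_coded_equiv hA s ⟨x, hx⟩
  have h1 : DGraph M ⊨ existsCodeF Δ :=
    (realize_existsCodeF Δ).2 ⟨p, ⟨e ⟨x, hx⟩⟩, StrongHomClass.theory_model e⟩
  obtain ⟨q, hq, hqΔ⟩ := (realize_existsCodeF Δ).1
    ((realize_iff_of_model_completeTheory (DGraph M) N _).2 h1)
  exact ⟨Coded q, inferInstance, hq, hqΔ, interprets_coded q⟩

end Coding

/-! ### Dividing lines -/

section DividingLines

/-- Compactness: if initial segments of a sequence of formulas are satisfied in `K`, then some model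
of the complete theory of `K` satisfies all of them. -/
theorem exists_model_realizing_sequence {L : FirstOrder.Language.{0, 0}} {K : Type u} [L.Structure K]
    [Nonempty K] {α : Type} (φ : ℕ → L.Formula α)
    (h : ∀ n, ∃ v : α → K, ∀ m ≤ n, (φ m).Realize v) :
    ∃ (N : Theory.ModelType.{0, 0, 0} (L.completeTheory K)) (v : α → N), ∀ n, (φ n).Realize v := by
  classical
  let T' : L[[α]].Theory := (L.lhomWithConstants α).onTheory (L.completeTheory K) ∪
    Set.range fun n => Formula.equivSentence (φ n)
  have hT' : T'.IsSatisfiable := by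
    rw [Theory.isSatisfiable_iff_isFinitelySatisfiable]
    intro T₀ hT₀
    obtain ⟨n, hn⟩ : ∃ n : ℕ, ∀ σ ∈ T₀, σ ∈ (L.lhomWithConstants α).onTheory (L.completeTheory K) ∨
        ∃ m ≤ n, Formula.equivSentence (φ m) = σ := by
      clear h
      induction T₀ using Finset.induction_on with
      | empty => exact ⟨0, by simp⟩
      | insert σ T₀ _ ih =>
        rw [Finset.coe_insert, Set.insert_subset_iff] at hT₀
        obtain ⟨n, hn⟩ := ih hT₀.2
        rcases hT₀.1 with h | ⟨m, rfl⟩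
        · exact ⟨n, (Finset.forall_mem_insert _ _ _).2 ⟨Or.inl h, hn⟩⟩
        · refine ⟨max n m, fun τ hτ => ?_⟩
          rcases Finset.mem_insert.1 hτ with rfl | hτ
          · exact Or.inr ⟨m, le_max_right _ _, rfl⟩
          · exact (hn τ hτ).imp_right fun ⟨m', h, h'⟩ => ⟨m', h.trans (le_max_left _ _), h'⟩
    obtain ⟨v, hv⟩ := h n
    let _ : (constantsOn α).Structure K := constantsOn.structure v
    have hK : K ⊨ (T₀ : L[[α]].Theory) := by
      refine (Theory.model_iff _).2 fun σ hσ => ?_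
      rcases hn σ hσ with h | ⟨m, hm, rfl⟩
      · have : K ⊨ (L.lhomWithConstants α).onTheory (L.completeTheory K) :=
          (LHom.onTheory_model _ _).2 inferInstance
        exact (Theory.model_iff _).1 this σ h
      · exact (Formula.realize_equivSentence K (φ m)).2 (hv m hm)
    exact Theory.Model.isSatisfiable K
  obtain ⟨N⟩ := hT'
  let N₁ : Theory.ModelType ((L.lhomWithConstants α).onTheory (L.completeTheory K)) :=
    N.subtheoryModel Set.subset_union_left
  refine ⟨N₁.reduct, fun a => (L.con a : N), fun n => ?_⟩
  have h1 : N ⊨ Formula.equivSentence (φ n) :=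
    Theory.realize_sentence_of_mem T' (Or.inr ⟨n, rfl⟩)
  let _ := (L.lhomWithConstants α).reduct N
  exact (Formula.realize_equivSentence N (φ n)).1 h1

variable {M : Type u} [memLang.Structure M] [hM : M ⊨ ZFCWithoutFoundation]

/-- Every finite symmetric graph is isomorphic to a union of connected components of the
double-membership graph. -/
theorem exists_realization_of_finite_graph (hA : M ⊨ antiFoundation) {I : Type} [Finite I]
    {G : I → I → Prop} (symm : ∀ i j, G i j → G j i) :
    ∃ u : I → DGraph M, Function.Injective u ∧
      ∀ i y, Adj (u i) y ↔ ∃ j, G i j ∧ y = u j := by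
  obtain ⟨s, hs⟩ := IsSet.singleton (emp M)
  obtain ⟨u, hinj, hu⟩ := exists_realization_of_family hA s (R := fun i j _ _ => G i j)
    (fun i j => by
      by_cases h : G i j
      · simpa [FO₂, h] using FO.true
      · simpa [FO₂, h] using FO.false)
    (fun i j _ _ => symm i j)
  have he := (hs (emp M)).2 rfl
  refine ⟨fun i => u i (emp M), fun i j h => (hinj i j _ _ he he h).1, fun i y => ?_⟩
  refine (hu i _ he y).trans ⟨?_, ?_⟩
  · rintro ⟨j, z, hz, h, rfl⟩
    rw [(hs z).1 hz]
    exact ⟨j, h, rfl⟩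
  · rintro ⟨j, h, rfl⟩
    exact ⟨j, emp M, he, h, rfl⟩

theorem ofNat_eq_castLE {m n : ℕ} (h : m ≤ n + 1) (i : Fin m) :
    Fin.ofNat (n + 1) (i : ℕ) = Fin.castLE h i :=
  Fin.ext (Nat.mod_eq_of_lt (i.2.trans_le h))

/-- The formula `D(y, x)`, with the object variable `x` on the left and the parameter variable `y` on
the right. -/
def adjXY : FirstOrder.Language.graph.Formula (Fin 1 ⊕ Fin 1) :=
  adjF (n := 0) (Sum.inl (Sum.inr 0)) (Sum.inl (Sum.inl 0))

theorem realize_adjXY {N : Type w} [FirstOrder.Language.graph.Structure N] {x y : Fin 1 → N} :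
    adjXY.Realize (Sum.elim x y) ↔ Adj (y 0) (x 0) := by
  simp [adjXY, Formula.Realize]

/-- The neighbourhoods of `v₀, …, vₙ₋₁` increase strictly. -/
noncomputable def chainF (n : ℕ) : FirstOrder.Language.graph.Formula ℕ :=
  BoundedFormula.iInf fun p : {p : Fin n × Fin n // p.1 < p.2} =>
    (∀' ((adjF (n := 1) (Sum.inl p.1.1.1) (Sum.inr 0)).imp
      (adjF (Sum.inl p.1.2.1) (Sum.inr 0)))) ⊓
    ∃' (adjF (n := 1) (Sum.inl p.1.2.1) (Sum.inr 0) ⊓ ∼(adjF (Sum.inl p.1.1.1) (Sum.inr 0)))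

theorem realize_chainF {N : Type w} [FirstOrder.Language.graph.Structure N] {n : ℕ} {v : ℕ → N} :
    (chainF n).Realize v ↔ ∀ i j : Fin n, i < j →
      (∀ x, Adj (v i) x → Adj (v j) x) ∧ ∃ x, Adj (v j) x ∧ ¬ Adj (v i) x := by
  simp [chainF, Formula.Realize, Fin.snoc]

/-- Half graphs are realized, so there are arbitrarily long strictly increasing chains of
neighbourhoods. -/
theorem hasSOP_dGraph (hA : M ⊨ antiFoundation) :
    HasSOP (FirstOrder.Language.graph.completeTheory (DGraph M)) := by
  have : Nonempty (DGraph M) := nonempty_of_model M hM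
  obtain ⟨N, b, hb⟩ := exists_model_realizing_sequence (K := DGraph M) chainF fun n => by
    let G : Fin (n + 1) ⊕ Fin (n + 1) → Fin (n + 1) ⊕ Fin (n + 1) → Prop
      | .inl j, .inr i => i < j
      | .inr i, .inl j => i < j
      | _, _ => False
    obtain ⟨u, hinj, hu⟩ := exists_realization_of_finite_graph hA (G := G) (by
      rintro (i | i) (j | j) h <;> exact h)
    have hu' : ∀ j y, Adj (u (.inl j)) y ↔ ∃ i, i < j ∧ y = u (.inr i) := fun j y => by
      simp [hu, G]
    refine ⟨fun i => u (.inl (Fin.ofNat (n + 1) i)), fun m hm => realize_chainF.2 fun i j hij => ?_⟩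
    simp only [ofNat_eq_castLE (hm.trans n.le_succ), hu']
    refine ⟨?_, u (.inr (Fin.castLE (hm.trans n.le_succ) i)), ⟨_, hij, rfl⟩, ?_⟩
    · rintro _ ⟨k, hk, rfl⟩
      exact ⟨k, hk.trans hij, rfl⟩
    · rintro ⟨k, hk, h⟩
      rw [← Sum.inr_injective (hinj h)] at hk
      exact lt_irrefl _ hk
  refine ⟨1, 1, adjXY, N, fun i _ => b i, fun i j hij => ?_⟩
  obtain ⟨h1, x, h2, h3⟩ := realize_chainF.1 (hb (j + 1)) ⟨i, hij.trans j.lt_succ_self⟩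
    ⟨j, j.lt_succ_self⟩ hij
  refine (Set.ssubset_iff_of_subset fun y hy => ?_).2 ⟨fun _ => x, ?_, fun h => h3 ?_⟩
  · exact realize_adjXY.2 (h1 _ (realize_adjXY.1 hy))
  · exact realize_adjXY.2 h2
  · exact realize_adjXY.1 h

/-- For the array `(vᵢⱼ)`, `i, j < n`, the neighbourhoods of two entries in the same row are
disjoint, while every choice of one entry from each row has a common neighbour. -/
noncomputable def arrayF (n : ℕ) : FirstOrder.Language.graph.Formula (ℕ × ℕ) :=
  (BoundedFormula.iInf fun p : {p : Fin n × Fin n × Fin n // p.2.1 ≠ p.2.2} =>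
    ∼(∃' (adjF (n := 1) (Sum.inl (p.1.1.1, p.1.2.1.1)) (Sum.inr 0) ⊓
      adjF (Sum.inl (p.1.1.1, p.1.2.2.1)) (Sum.inr 0)))) ⊓
  BoundedFormula.iInf fun η : Fin n → Fin n =>
    ∃' BoundedFormula.iInf fun i : Fin n => adjF (n := 1) (Sum.inl (i.1, (η i).1)) (Sum.inr 0)

theorem realize_arrayF {N : Type w} [FirstOrder.Language.graph.Structure N] {n : ℕ}
    {v : ℕ × ℕ → N} : (arrayF n).Realize v ↔
      (∀ i j j' : Fin n, j ≠ j' → ¬ ∃ x, Adj (v (i, j)) x ∧ Adj (v (i, j')) x) ∧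
      ∀ η : Fin n → Fin n, ∃ x, ∀ i : Fin n, Adj (v (i, η i)) x := by
  simp [arrayF, Formula.Realize, Fin.snoc]

/-- Finite incidence graphs of entries of an array against choice functions are realized, a choice
function being adjacent to the entries that it chooses. -/
theorem hasTP2_dGraph (hA : M ⊨ antiFoundation) :
    HasTP2 (FirstOrder.Language.graph.completeTheory (DGraph M)) := by
  have : Nonempty (DGraph M) := nonempty_of_model M hM
  obtain ⟨N, b, hb⟩ := exists_model_realizing_sequence (K := DGraph M) arrayF fun n => by
    let G : (Fin (n + 1) × Fin (n + 1)) ⊕ (Fin (n + 1) → Fin (n + 1)) →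
        (Fin (n + 1) × Fin (n + 1)) ⊕ (Fin (n + 1) → Fin (n + 1)) → Prop
      | .inl p, .inr η => η p.1 = p.2
      | .inr η, .inl p => η p.1 = p.2
      | _, _ => False
    obtain ⟨u, hinj, hu⟩ := exists_realization_of_finite_graph hA (G := G) (by
      rintro (i | i) (j | j) h <;> exact h)
    have hu' : ∀ p y, Adj (u (.inl p)) y ↔ ∃ η : Fin (n + 1) → Fin (n + 1),
        η p.1 = p.2 ∧ y = u (.inr η) := fun p y => by
      simp [hu, G]
    refine ⟨fun p => u (.inl (Fin.ofNat (n + 1) p.1, Fin.ofNat (n + 1) p.2)), fun m hm =>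
      realize_arrayF.2 ⟨fun i j j' hj => ?_, fun η => ?_⟩⟩
    all_goals simp only [ofNat_eq_castLE (hm.trans n.le_succ), hu']
    · rintro ⟨_, ⟨η, h1, rfl⟩, η', h2, h⟩
      rw [← Sum.inr_injective (hinj h), h1] at h2
      exact hj (Fin.castLE_injective _ h2)
    · refine ⟨_, fun i => ⟨fun i => if h : i.1 < m then Fin.castLE (hm.trans n.le_succ) (η ⟨i, h⟩)
        else 0, ?_, rfl⟩⟩
      simp
  -- The formula `arrayF n` speaks of square arrays, and a finite part of the infinite array is
  -- covered by `arrayF n` for large `n`.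
  refine ⟨1, 1, adjXY, N, fun i j _ => b (i, j), fun i j j' hj => ?_, fun η I => ?_⟩
  · rintro ⟨x, h1, h2⟩
    refine (realize_arrayF.1 (hb (i + j + j' + 1))).1 ⟨i, by omega⟩ ⟨j, by omega⟩ ⟨j', by omega⟩
      (by simpa using hj) ⟨x 0, realize_adjXY.1 h1, realize_adjXY.1 h2⟩
  · obtain ⟨n, hn⟩ : ∃ n : ℕ, ∀ i ∈ I, i < n ∧ η i < n :=
      ⟨I.sup (fun i => i + η i) + 1, fun i hi => by
        have := Finset.le_sup (f := fun i => i + η i) hi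
        omega⟩
    obtain ⟨x, hx⟩ := (realize_arrayF.1 (hb n)).2 fun i =>
      if h : η i < n then ⟨η i, h⟩ else i
    refine ⟨fun _ => x, fun i hi => realize_adjXY.2 ?_⟩
    have := hx ⟨i, (hn i hi).1⟩
    simpa [(hn i hi).2] using this

/-- `x` has a neighbour that is adjacent to all of `y₁, …, yₖ`. -/
def Joined {N : Type w} [FirstOrder.Language.graph.Structure N] {k : ℕ} (x : N) (y : Fin k → N) :
    Prop := ∃ e, Adj x e ∧ ∀ i, Adj e (y i)

/-- The formula defining `Joined`. -/
noncomputable def joinedF {α : Type} {k n : ℕ} (x : α ⊕ Fin n) (y : Fin k → α) :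
    FirstOrder.Language.graph.BoundedFormula α n :=
  ∃' (adjF (Sum.map id Fin.castSucc x) (Sum.inr (Fin.last n)) ⊓
    BoundedFormula.iInf fun i => adjF (Sum.inr (Fin.last n)) (Sum.inl (y i)))

@[simp]
theorem realize_joinedF {N : Type w} [FirstOrder.Language.graph.Structure N] {α : Type} {k n : ℕ}
    {x : α ⊕ Fin n} {y : Fin k → α} {v : α → N} {xs : Fin n → N} :
    (joinedF x y).Realize v xs ↔ Joined (Sum.elim v xs x) (fun i => v (y i)) := by
  cases x <;> simp [joinedF, Joined]

open Classical in
/-- For the sequences `(vᵢⱼ)`, `i < k`, `j < n`, every set of transversals is defined by `Joined`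
for some `x`. -/
noncomputable def shatteredF (k n : ℕ) : FirstOrder.Language.graph.Formula (Fin k × ℕ) :=
  BoundedFormula.iInf fun X : Set (Fin k → Fin n) =>
    ∃' BoundedFormula.iInf fun η : Fin k → Fin n =>
      if η ∈ X then joinedF (n := 1) (Sum.inr 0) fun i => (i, (η i).1)
      else ∼(joinedF (n := 1) (Sum.inr 0) fun i => (i, (η i).1))

theorem realize_shatteredF {N : Type w} [FirstOrder.Language.graph.Structure N] {k n : ℕ}
    {v : Fin k × ℕ → N} : (shatteredF k n).Realize v ↔
      ∀ X : Set (Fin k → Fin n), ∃ x, ∀ η : Fin k → Fin n,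
        Joined x (fun i => v (i, η i)) ↔ η ∈ X := by
  unfold shatteredF Formula.Realize
  simp only [BoundedFormula.realize_iInf, BoundedFormula.realize_ex]
  refine forall_congr' fun X => exists_congr fun x => forall_congr' fun η => ?_
  by_cases h : η ∈ X <;> simp [h, Fin.snoc]

/-- Finite graphs in which all sets of transversals of an array are defined by `Joined` are
realized. -/
theorem hasIP_dGraph (hA : M ⊨ antiFoundation) (k : ℕ) :
    HasIP k (FirstOrder.Language.graph.completeTheory (DGraph M)) := by
  have : Nonempty (DGraph M) := nonempty_of_model M hM
  obtain ⟨N, b, hb⟩ := exists_model_realizing_sequence (K := DGraph M) (shatteredF k) fun n => by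
    -- The vertices are the entries of the array, the sets `X` of transversals, and, for each such
    -- set, a vertex for every transversal, which is adjacent to its entries, and to `X` if it
    -- belongs to `X`.
    let T := Fin k → Fin (n + 1)
    let G : (Fin k × Fin (n + 1)) ⊕ Set T ⊕ (Set T × T) →
        (Fin k × Fin (n + 1)) ⊕ Set T ⊕ (Set T × T) → Prop
      | .inl p, .inr (.inr (_, η)) => η p.1 = p.2
      | .inr (.inr (_, η)), .inl p => η p.1 = p.2
      | .inr (.inl X), .inr (.inr (Y, η)) => X = Y ∧ η ∈ X
      | .inr (.inr (Y, η)), .inr (.inl X) => X = Y ∧ η ∈ X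
      | _, _ => False
    obtain ⟨u, hinj, hu⟩ := exists_realization_of_finite_graph hA (G := G) (by
      rintro (i | i | i) (j | j | j) h <;> exact h)
    have joined_iff : ∀ (X : Set T) (η : T),
        Joined (u (.inr (.inl X))) (fun i => u (.inl (i, η i))) ↔ η ∈ X := by
      intro X η
      constructor
      · rintro ⟨e, h1, h2⟩
        obtain ⟨_ | _ | ⟨Y, η'⟩, h, rfl⟩ := (hu _ _).1 h1 <;> simp only [G] at h
        have : η' = η := funext fun i => by
          obtain ⟨j, hj, h'⟩ := (hu _ _).1 (h2 i)
          rw [← hinj h'] at hj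
          exact hj
        exact this ▸ h.2
      · intro h
        exact ⟨u (.inr (.inr (X, η))), (hu _ _).2 ⟨.inr (.inr (X, η)), ⟨rfl, h⟩, rfl⟩, fun i =>
          (hu _ _).2 ⟨.inl (i, η i), rfl, rfl⟩⟩
    refine ⟨fun p => u (.inl (p.1, Fin.ofNat (n + 1) p.2)), fun m hm =>
      realize_shatteredF.2 fun X => ?_⟩
    have hm' := hm.trans n.le_succ
    refine ⟨u (.inr (.inl ((fun (η : Fin k → Fin m) i => Fin.castLE hm' (η i)) '' X))), fun η => ?_⟩
    simp only [ofNat_eq_castLE hm']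
    rw [joined_iff _ (fun i => Fin.castLE hm' (η i))]
    refine Function.Injective.mem_set_image (f := fun (η : Fin k → Fin m) i => Fin.castLE hm' (η i))
      fun η η' h => funext fun i => Fin.castLE_injective hm' (congrFun h i)
  refine ⟨1, fun _ => 1, joinedF (n := 0) (Sum.inl (Sum.inl 0)) (fun i => Sum.inr ⟨i, 0⟩), N,
    fun i j _ => b (i, j), fun X I => ?_⟩
  obtain ⟨n, hn⟩ : ∃ n : ℕ, ∀ η ∈ I, ∀ i, η i < n :=
    ⟨I.sup (fun η => Finset.univ.sup η) + 1, fun η hη i => Nat.lt_succ_of_le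
      ((Finset.le_sup (f := η) (Finset.mem_univ i)).trans
        (Finset.le_sup (f := fun η : Fin k → ℕ => Finset.univ.sup η) hη))⟩
  obtain ⟨x, hx⟩ := realize_shatteredF.1 (hb n) {η | (fun i => (η i : ℕ)) ∈ X}
  refine ⟨fun _ => x, fun η hη => ?_⟩
  refine Iff.trans ?_ (hx fun i => ⟨η i, hn η hη i⟩)
  rw [Formula.Realize, realize_joinedF]
  exact Iff.rfl

end DividingLines

end DoubleMembership

theorem mainTheorem7 (M : Type*) [DoubleMembership.memLang.Structure M]
    (hM : M ⊨ DoubleMembership.ZFA) :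
    (∀ (N : Type*) [FirstOrder.Language.graph.Structure N],
      N ⊨ FirstOrder.Language.graph.completeTheory (DoubleMembership.DGraph M) →
      ∀ Δ : DoubleMembership.memLang.Theory, Δ ⊆ DoubleMembership.ZFC → Δ.Finite →
        DoubleMembership.InterpretsTheory FirstOrder.Language.graph N Δ) ∧
    DoubleMembership.HasSOP (FirstOrder.Language.graph.completeTheory (DoubleMembership.DGraph M)) ∧
    DoubleMembership.HasTP2 (FirstOrder.Language.graph.completeTheory (DoubleMembership.DGraph M)) ∧
    (∀ k : ℕ, 1 ≤ k →
      DoubleMembership.HasIP k (FirstOrder.Language.graph.completeTheory (DoubleMembership.DGraph M))) := by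
  have : M ⊨ DoubleMembership.ZFCWithoutFoundation := hM.mono Set.subset_union_left
  have hA : M ⊨ DoubleMembership.antiFoundation :=
    FirstOrder.Language.Theory.realize_sentence_of_mem DoubleMembership.ZFA (Or.inr rfl)
  exact ⟨fun N _ hN Δ hΔ hfin =>
      DoubleMembership.interpretsTheory_of_model_completeTheory hA N hN Δ hΔ hfin,
    DoubleMembership.hasSOP_dGraph hA, DoubleMembership.hasTP2_dGraph hA,
    fun k _ => DoubleMembership.hasIP_dGraph hA k⟩
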